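/- Let $\pi\colon E\to\mathbb R$ be a smooth fibre bundle with $\dim E=n+1$ and bundle coordinates $(t,q^A)$, $A=1,\dots,n$. Let $J^1\pi$ be its first jet space, identified with the affine subbundle $\{v\in TE : \langle dt,v\rangle=1\}$ of $TE$ by the natural embedding $j$, with coordinates $(t,q^A,\dot q^A)$ and projections $\pi_{1,0}\colon J^1\pi\to E$, $\pi_1=\pi\circ\pi_{1,0}$. Let $L\in C^\infty(J^1\pi)$ be a regular Lagrangian, i.e. the matrix $\bigl(\partial^2L/\partial\dot q^A\partial\dot q^B\bigr)$ is non-singular everywhere. Put $\tilde\eta=\pi_1^*dt$, let $\tilde S=(dq^A-\dot q^A dt)\otimes\partial/\partial\dot q^A$ be the vertical endomorphism, and let $\Theta_L=L\,\tilde\eta+\tilde S^*(dL)$ and $\omega_L=-d\Theta_L$ be the Poincaré–Cartan forms. The extended Legendre map $\mathrm{Leg}_L\colon J^1\pi\to T^*E$ is defined by $\mathrm{Leg}_L(v)(w)=\Theta_L(\tilde w)$ for any $\tilde w\in T_vJ^1\pi$ with $(\pi_{1,0})_*\tilde w=w$; in coordinates $\tau=L-\dot q^A\,\partial L/\partial\dot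 q^A$, $p_A=\partial L/\partial\dot q^A$. On the fibred product $T^*E\times_E J^1\pi$, with projections $pr_1,pr_2$ onto the factors and $pr$ onto $E$, put $$\eta=(\pi\circ pr)^*dt,\qquad \mathcal H=\langle pr_1,\,j\circ pr_2\rangle-pr_2^*L,\qquad \omega_{\mathcal H}=pr_1^*\omega_E+d\mathcal H\wedge\eta ,$$ where $\omega_E=dq^A\wedge dp_A+dt\wedge d\tau$ is the canonical symplectic form of $T^*E$. Let $\mathrm{graph}_L$ be the image of the map $\mathrm{Leg}_L\times_E \mathrm{id}\colon J^1\pi\to T^*E\times_EJ^1\pi$. Then: (i) there is exactly one vector field $X_L$ on $J^1\pi$ with $i_{X_L}\omega_L=0$ and $i_{X_L}\tilde\eta=1$ (the Euler–Lagrange vector field), and it is smooth; (ii) there is exactly one vector field $Z$ on $T^*E\times_EJ^1\pi$ defined along $\mathrm{graph}_L$ and tangent to $\mathrm{graph}_L$ that satisfies $i_Z\omega_{\mathcal H}=0$ and $i_Z\eta=1$ at all points of $\mathrm{graph}_L$, and it is smooth; (iii) $Z$ is $(\mathrm{Leg}_L\times_E\mathrm{id})$-related to $X_L$: for every $x\in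 J^1\pi$, $(\mathrm{Leg}_L\times_E \mathrm{id})_*(X_L)_x=Z_{\bar x}$ with $\bar x=(\mathrm{Leg}_L\times_E\mathrm{id})(x)$. -/

import Mathlib

open Set Topology
open scoped Manifold ContDiff

noncomputable section
namespace SkinnerRusk
universe u

/-- Model space of the fibres, with coordinates `q^1, …, q^n`. -/
abbrev Fib (n : ℕ) : Type := EuclideanSpace ℝ (Fin n)
/-- Model space of the total space `E`, with coordinates `(t, q)`; `dim E = n + 1`. -/
abbrev EMod (n : ℕ) : Type := ℝ × Fib n

section
variable {n : ℕ} {E : Type u} [TopologicalSpace E] [ChartedSpace (EMod n) E]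

/-- `π : E → ℝ` is a smooth locally trivial fibre bundle whose typical fibre is a smooth
`n`-dimensional manifold. (The typical fibre is diffeomorphic to any fibre of `π`, hence may be taken
in the universe of `E`.) -/
class IsFibreBundle (n : ℕ) {E : Type u} [TopologicalSpace E] [ChartedSpace (EMod n) E]
    (π : E → ℝ) : Prop where
  exists_trivialization : ∃ (Q : Type u) (_ : TopologicalSpace Q) (_ : ChartedSpace (Fib n) Q)
    (_ : IsManifold 𝓘(ℝ, Fib n) ∞ Q), ∀ t : ℝ, ∃ e : Bundle.Trivialization Q π, t ∈ e.baseSet ∧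
      ContMDiffOn 𝓘(ℝ, EMod n) (𝓘(ℝ, ℝ).prod 𝓘(ℝ, Fib n)) ∞ e e.source ∧
      ContMDiffOn (𝓘(ℝ, ℝ).prod 𝓘(ℝ, Fib n)) 𝓘(ℝ, EMod n) ∞ e.toOpenPartialHomeomorph.symm e.target

/-- Bundle charts `(t, q^A)` of `E`: local diffeomorphisms onto open subsets of `ℝ × ℝⁿ` whose first
coordinate is `π`. -/
structure IsBundleChart (π : E → ℝ) (φ : OpenPartialHomeomorph E (EMod n)) : Prop where
  smooth : ContMDiffOn 𝓘(ℝ, EMod n) 𝓘(ℝ, EMod n) ∞ φ φ.source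
  smooth_symm : ContMDiffOn 𝓘(ℝ, EMod n) 𝓘(ℝ, EMod n) ∞ φ.symm φ.target
  fst_eq : ∀ x ∈ φ.source, (φ x).1 = π x

/-- The differential of `φ` at `x`. -/
def toMod (φ : OpenPartialHomeomorph E (EMod n)) (x : E) :
    TangentSpace 𝓘(ℝ, EMod n) x →L[ℝ] EMod n :=
  mvfderiv 𝓘(ℝ, EMod n) φ x

/-- The differential of `φ⁻¹` at `y`. -/
def fromMod (φ : OpenPartialHomeomorph E (EMod n)) (y : EMod n) :
    EMod n →L[ℝ] TangentSpace 𝓘(ℝ, EMod n) (φ.symm y) :=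
  mfderiv 𝓘(ℝ, EMod n) 𝓘(ℝ, EMod n) φ.symm y

/-- Bundle charts cover `E`. -/
theorem exists_bundleChart (π : E → ℝ) [h : IsFibreBundle n π] (x : E) :
    ∃ φ : OpenPartialHomeomorph E (EMod n), IsBundleChart π φ ∧ x ∈ φ.source := by
  obtain ⟨Q, _, _, _, hQ⟩ := h.exists_trivialization
  obtain ⟨e, het, he, he'⟩ := hQ (π x)
  have hx : x ∈ e.source := e.mem_source.2 het
  let c := chartAt (Fib n) (e x).2
  let d := (OpenPartialHomeomorph.refl ℝ).prod c
  have hd : ContMDiffOn (𝓘(ℝ, ℝ).prod 𝓘(ℝ, Fib n)) 𝓘(ℝ, EMod n) ∞ d d.source := by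
    rw [modelWithCornersSelf_prod, ← chartedSpaceSelf_prod]
    exact contMDiffOn_id.prodMap contMDiffOn_chart
  have hd' : ContMDiffOn 𝓘(ℝ, EMod n) (𝓘(ℝ, ℝ).prod 𝓘(ℝ, Fib n)) ∞ d.symm d.target := by
    rw [modelWithCornersSelf_prod, ← chartedSpaceSelf_prod]
    exact contMDiffOn_id.prodMap contMDiffOn_chart_symm
  refine ⟨e.toOpenPartialHomeomorph ≫ₕ d, ⟨?_, ?_, ?_⟩, ?_⟩
  · exact hd.comp' he |>.mono (by intro y hy; simpa using hy)
  · exact he'.comp' hd' |>.mono (by intro y hy; simpa using hy)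
  · intro y hy
    exact e.coe_fst (by simp at hy; exact hy.1)
  · simp [d, c, hx]

namespace IsBundleChart
variable {π : E → ℝ} {φ ψ : OpenPartialHomeomorph E (EMod n)}

theorem mdiff (hφ : IsBundleChart π φ) :
    φ.MDifferentiable 𝓘(ℝ, EMod n) 𝓘(ℝ, EMod n) :=
  ⟨hφ.smooth.mdifferentiableOn (by simp), hφ.smooth_symm.mdifferentiableOn (by simp)⟩

theorem toMod_fromMod (hφ : IsBundleChart π φ) {y : EMod n} (hy : y ∈ φ.target) (w : EMod n) :
    toMod φ (φ.symm y) (fromMod φ y w) = w :=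
  DFunLike.congr_fun (hφ.mdiff.comp_symm_deriv hy) w

theorem fromMod_toMod (hφ : IsBundleChart π φ) {y : EMod n} (hy : y ∈ φ.target)
    (w : TangentSpace 𝓘(ℝ, EMod n) (φ.symm y)) :
    fromMod φ y (toMod φ (φ.symm y) w) = w := by
  have h := DFunLike.congr_fun (hφ.mdiff.symm_comp_deriv (φ.map_target hy)) w
  have h2 : φ (φ.symm y) = y := φ.right_inv hy
  change (mfderiv 𝓘(ℝ, EMod n) 𝓘(ℝ, EMod n) φ.symm (φ (φ.symm y)) : EMod n → EMod n) _ = w at h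
  rw [h2] at h
  exact h

theorem toMod_inverse (hφ : IsBundleChart π φ) {y : EMod n} (hy : y ∈ φ.target) :
    (toMod φ (φ.symm y)).inverse = fromMod φ y :=
  ContinuousLinearMap.inverse_eq (ContinuousLinearMap.ext (hφ.toMod_fromMod hy))
    (ContinuousLinearMap.ext (hφ.fromMod_toMod hy))

theorem transition_contDiffOn (hφ : IsBundleChart π φ) (hψ : IsBundleChart π ψ) :
    ContDiffOn ℝ ∞ (ψ ∘ φ.symm) (φ.symm ≫ₕ ψ).source := by
  rw [← contMDiffOn_iff_contDiffOn]
  exact hψ.smooth.comp' hφ.smooth_symm |>.mono (by intro y hy; simpa using hy)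

theorem toMod_fromMod_transition (hφ : IsBundleChart π φ) (hψ : IsBundleChart π ψ) {y : EMod n}
    (hy : y ∈ (φ.symm ≫ₕ ψ).source) (w : EMod n) :
    toMod ψ (φ.symm y) (fromMod φ y w) = fderiv ℝ (ψ ∘ φ.symm) y w := by
  simp only [OpenPartialHomeomorph.trans_source, OpenPartialHomeomorph.symm_source, mem_inter_iff,
    mem_preimage] at hy
  have h := mfderiv_comp (I := 𝓘(ℝ, EMod n)) (I' := 𝓘(ℝ, EMod n)) (I'' := 𝓘(ℝ, EMod n)) y
    (hψ.mdiff.mdifferentiableAt hy.2) (hφ.mdiff.symm.mdifferentiableAt hy.1)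
  rw [mfderiv_eq_fderiv] at h
  exact (DFunLike.congr_fun h w).symm

theorem dt_eq (hφ : IsBundleChart π φ) {x : E} (hx : x ∈ φ.source)
    (w : TangentSpace 𝓘(ℝ, EMod n) x) :
    mvfderiv 𝓘(ℝ, EMod n) π x w = (toMod φ x w).1 := by
  have h1 : (fun z => (φ z).1) =ᶠ[𝓝 x] π :=
    Filter.eventuallyEq_of_mem (φ.open_source.mem_nhds hx) hφ.fst_eq
  have h2 := h1.mfderiv_eq (I := 𝓘(ℝ, EMod n)) (I' := 𝓘(ℝ, ℝ))
  have h3 := mfderiv_comp (I := 𝓘(ℝ, EMod n)) (I' := 𝓘(ℝ, EMod n)) (I'' := 𝓘(ℝ, ℝ)) x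
    (g := Prod.fst) (f := φ)
    (ContinuousLinearMap.fst ℝ ℝ (Fib n)).mdifferentiableAt (hφ.mdiff.mdifferentiableAt hx)
  have h4 : mfderiv 𝓘(ℝ, EMod n) 𝓘(ℝ, ℝ) (Prod.fst : EMod n → ℝ) (φ x)
      = ContinuousLinearMap.fst ℝ ℝ (Fib n) :=
    (ContinuousLinearMap.fst ℝ ℝ (Fib n)).hasMFDerivAt.mfderiv
  rw [h4] at h3
  change mfderiv 𝓘(ℝ, EMod n) 𝓘(ℝ, ℝ) π x w = _
  have h5 := h2.symm.trans h3
  exact DFunLike.congr_fun h5 w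

end IsBundleChart

theorem exists_unit (π : E → ℝ) [IsFibreBundle n π] (x : E) :
    ∃ w : TangentSpace 𝓘(ℝ, EMod n) x, mvfderiv 𝓘(ℝ, EMod n) π x w = 1 := by
  obtain ⟨φ, hφ, hx⟩ := exists_bundleChart (n := n) π x
  obtain ⟨y, hy, rfl⟩ : ∃ y ∈ φ.target, φ.symm y = x := ⟨φ x, φ.map_source hx, φ.left_inv hx⟩
  exact ⟨fromMod φ y (1, 0), by rw [hφ.dt_eq hx, hφ.toMod_fromMod hy]⟩


/-- An atlas with smooth transition maps makes a smooth manifold. -/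
theorem isManifold_of_core {V : Type*} [NormedAddCommGroup V] [NormedSpace ℝ V] {M : Type*}
    (c : ChartedSpaceCore V M)
    (h : ∀ e e' : PartialEquiv M V, e ∈ c.atlas → e' ∈ c.atlas →
      ContDiffOn ℝ ∞ (e.symm.trans e') (e.symm.trans e').source) :
    @IsManifold ℝ _ V _ _ V _ 𝓘(ℝ, V) ∞ M c.toTopologicalSpace c.toChartedSpace := by
  let _ := c.toTopologicalSpace
  let _ := c.toChartedSpace
  apply isManifold_of_contDiffOn
  rintro e e' he he'
  obtain ⟨f, hf, rfl⟩ : ∃ f, ∃ hf : f ∈ c.atlas, e = c.openPartialHomeomorph f hf := by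
    simpa only [exists_prop, mem_iUnion, mem_singleton_iff] using
      (show e ∈ ⋃ (f : PartialEquiv M V) (hf : f ∈ c.atlas), {c.openPartialHomeomorph f hf} from he)
  obtain ⟨f', hf', rfl⟩ : ∃ f, ∃ hf : f ∈ c.atlas, e' = c.openPartialHomeomorph f hf := by
    simpa only [exists_prop, mem_iUnion, mem_singleton_iff] using
      (show e' ∈ ⋃ (f : PartialEquiv M V) (hf : f ∈ c.atlas), {c.openPartialHomeomorph f hf}
        from he')
  exact (h f f' hf hf').mono (fun y hy => hy.1)

/-- The first jet space `J¹π`, as the affine subbundle `{v ∈ TE | ⟨dt, v⟩ = 1}` of `TE`. The field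
`pt` is the projection `π_{1,0} : J¹π → E`, and `vel` is the embedding `j : J¹π → TE`. -/
structure J1 (n : ℕ) {E : Type u} [TopologicalSpace E] [ChartedSpace (EMod n) E]
    (π : E → ℝ) where
  pt : E
  vel : TangentSpace 𝓘(ℝ, EMod n) pt
  dt_vel : mvfderiv 𝓘(ℝ, EMod n) π pt vel = 1

namespace J1
variable {π : E → ℝ}

theorem mk_congr {x : E} {u w : TangentSpace 𝓘(ℝ, EMod n) x}
    (hu : mvfderiv 𝓘(ℝ, EMod n) π x u = 1) (h : u = w) :
    (⟨x, u, hu⟩ : J1 n π) = ⟨x, w, h ▸ hu⟩ := by subst h; rfl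

/-- The jet with velocity `u` if `⟨dt, u⟩ = 1`; in general `u` is first corrected by a multiple of some
fixed vector, to have a total function. -/
def ofVec (π : E → ℝ) [IsFibreBundle n π] (x : E) (u : TangentSpace 𝓘(ℝ, EMod n) x) : J1 n π where
  pt := x
  vel := u + (1 - mvfderiv 𝓘(ℝ, EMod n) π x u) • (exists_unit π x).choose
  dt_vel := by
    rw [map_add, map_smul, (exists_unit (n := n) π x).choose_spec]; simp

theorem ofVec_eq [IsFibreBundle n π] {x : E} {u : TangentSpace 𝓘(ℝ, EMod n) x}
    (hu : mvfderiv 𝓘(ℝ, EMod n) π x u = 1) : ofVec π x u = ⟨x, u, hu⟩ :=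
  mk_congr _ (by rw [hu, sub_self, zero_smul, add_zero])

theorem ofVec_fromMod [IsFibreBundle n π] {φ : OpenPartialHomeomorph E (EMod n)}
    (hφ : IsBundleChart π φ) {y : EMod n} (hy : y ∈ φ.target) (w : Fib n) :
    (ofVec π (φ.symm y) (fromMod φ y (1, w))).vel = fromMod φ y (1, w) := by
  rw [ofVec_eq]
  rw [hφ.dt_eq (φ.map_target hy), hφ.toMod_fromMod hy]

variable [IsFibreBundle n π]

/-- The natural chart `(t, q, q̇)` of `J¹π` induced by a bundle chart `φ = (t, q)` of `E`. -/
def chart (φ : OpenPartialHomeomorph E (EMod n)) (hφ : IsBundleChart π φ) :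
    PartialEquiv (J1 n π) (EMod n × Fib n) where
  toFun v := (φ v.pt, (toMod φ v.pt v.vel).2)
  invFun z := ofVec π (φ.symm z.1) (fromMod φ z.1 (1, z.2))
  source := {v | v.pt ∈ φ.source}
  target := φ.target ×ˢ univ
  map_source' v hv := ⟨φ.map_source hv, mem_univ _⟩
  map_target' z hz := φ.map_target hz.1
  left_inv' := by
    rintro ⟨x, u, hu⟩ hx
    obtain ⟨y, hy, rfl⟩ : ∃ y ∈ φ.target, φ.symm y = x := ⟨φ x, φ.map_source hx, φ.left_inv hx⟩
    have h1 : ((1 : ℝ), (toMod φ (φ.symm y) u).2) = toMod φ (φ.symm y) u := by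
      ext1
      · rw [← hφ.dt_eq hx, hu]
      · rfl
    have key : ofVec π (φ.symm y) (fromMod φ y (1, (toMod φ (φ.symm y) u).2)) = ⟨φ.symm y, u, hu⟩ := by
      rw [h1, hφ.fromMod_toMod hy, ofVec_eq hu]
    have h2 : φ (φ.symm y) = y := φ.right_inv hy
    dsimp only
    rw [h2]
    exact key
  right_inv' := by
    rintro ⟨y, w⟩ ⟨hy, -⟩
    ext1
    · exact φ.right_inv hy
    · change (toMod φ (φ.symm y) (ofVec π (φ.symm y) (fromMod φ y (1, w))).vel).2 = w
      rw [ofVec_fromMod hφ hy, hφ.toMod_fromMod hy]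

theorem chart_trans_source {φ ψ : OpenPartialHomeomorph E (EMod n)} (hφ : IsBundleChart π φ)
    (hψ : IsBundleChart π ψ) :
    ((chart φ hφ).symm.trans (chart ψ hψ)).source = (φ.symm ≫ₕ ψ).source ×ˢ univ := by
  ext ⟨y, w⟩
  change ((y ∈ φ.target ∧ w ∈ univ) ∧ φ.symm y ∈ ψ.source) ↔
    ((y ∈ φ.target ∧ φ.symm y ∈ ψ.source) ∧ w ∈ univ)
  tauto

theorem chart_trans_contDiffOn {φ ψ : OpenPartialHomeomorph E (EMod n)} (hφ : IsBundleChart π φ)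
    (hψ : IsBundleChart π ψ) :
    ContDiffOn ℝ ∞ ((chart φ hφ).symm.trans (chart ψ hψ))
      ((chart φ hφ).symm.trans (chart ψ hψ)).source := by
  rw [chart_trans_source]
  have hg := hφ.transition_contDiffOn hψ
  have hfst : ContDiffOn ℝ ∞ (fun z : EMod n × Fib n => z.1) ((φ.symm ≫ₕ ψ).source ×ˢ univ) :=
    contDiff_fst.contDiffOn
  have hsnd : ContDiffOn ℝ ∞ (fun z : EMod n × Fib n => ((1 : ℝ), z.2))
      ((φ.symm ≫ₕ ψ).source ×ˢ univ) := (contDiff_const.prodMk contDiff_snd).contDiffOn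
  have hd := hg.fderiv_of_isOpen (m := ∞) (φ.symm ≫ₕ ψ).open_source (by simp)
  have h2 := (hd.comp hfst (fun z hz => hz.1)).clm_apply hsnd
  refine ((hg.comp hfst (fun z hz => hz.1)).prodMk (contDiff_snd.comp_contDiffOn h2)).congr ?_
  rintro ⟨y, w⟩ ⟨hy, -⟩
  have hy' : y ∈ φ.target := by simp at hy; exact hy.1
  ext1
  · rfl
  · change (toMod ψ (φ.symm y) (ofVec π (φ.symm y) (fromMod φ y (1, w))).vel).2 = _
    rw [ofVec_fromMod hφ hy', hφ.toMod_fromMod_transition hψ hy]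
    rfl

/-- The atlas of `J¹π` formed by all natural charts. -/
def core (n : ℕ) {E : Type u} [TopologicalSpace E] [ChartedSpace (EMod n) E] (π : E → ℝ)
    [IsFibreBundle n π] : ChartedSpaceCore (EMod n × Fib n) (J1 n π) where
  atlas := {c | ∃ φ, ∃ hφ : IsBundleChart π φ, c = chart φ hφ}
  chartAt v := chart (exists_bundleChart π v.pt).choose (exists_bundleChart π v.pt).choose_spec.1
  mem_chart_source v := (exists_bundleChart (n := n) π v.pt).choose_spec.2
  chart_mem_atlas v := ⟨_, _, rfl⟩
  open_source := by
    rintro _ _ ⟨φ, hφ, rfl⟩ ⟨ψ, hψ, rfl⟩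
    rw [chart_trans_source]
    exact (φ.symm ≫ₕ ψ).open_source.prod isOpen_univ
  continuousOn_toFun := by
    rintro _ _ ⟨φ, hφ, rfl⟩ ⟨ψ, hψ, rfl⟩
    exact (chart_trans_contDiffOn hφ hψ).continuousOn

instance : TopologicalSpace (J1 n π) := (core n π).toTopologicalSpace
instance : ChartedSpace (EMod n × Fib n) (J1 n π) := (core n π).toChartedSpace
instance : IsManifold 𝓘(ℝ, EMod n × Fib n) ∞ (J1 n π) :=
  isManifold_of_core _ (by
    rintro _ _ ⟨φ, hφ, rfl⟩ ⟨ψ, hψ, rfl⟩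
    exact chart_trans_contDiffOn hφ hψ)

end J1

/-- The fibred product `T*E ×_E J¹π`: a jet and a covector at the same point of `E`. -/
structure Mixed (n : ℕ) {E : Type u} [TopologicalSpace E] [ChartedSpace (EMod n) E]
    (π : E → ℝ) where
  jet : J1 n π
  cov : TangentSpace 𝓘(ℝ, EMod n) jet.pt →L[ℝ] ℝ

/-- Model space of `T*E ×_E J¹π`, with coordinates `((t, q), (τ, p), q̇)`. -/
abbrev PMod (n : ℕ) : Type := EMod n × (EMod n →L[ℝ] ℝ) × Fib n

namespace Mixed
variable {π : E → ℝ}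

theorem mk_congr {v w : J1 n π} {a : TangentSpace 𝓘(ℝ, EMod n) v.pt →L[ℝ] ℝ}
    {b : TangentSpace 𝓘(ℝ, EMod n) w.pt →L[ℝ] ℝ} (h : v = w) (h' : HEq a b) :
    (⟨v, a⟩ : Mixed n π) = ⟨w, b⟩ := by subst h; cases h'; rfl

variable [IsFibreBundle n π]

/-- The natural chart `((t, q), (τ, p), q̇)` of `T*E ×_E J¹π` induced by a bundle chart `φ = (t, q)`;
`(τ, p)` is recorded as the covector `τ dt + p dq` on the model space. -/
def chart (φ : OpenPartialHomeomorph E (EMod n)) (hφ : IsBundleChart π φ) :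
    PartialEquiv (Mixed n π) (PMod n) where
  toFun p := (φ p.jet.pt, p.cov ∘L (toMod φ p.jet.pt).inverse, (toMod φ p.jet.pt p.jet.vel).2)
  invFun z := ⟨J1.ofVec π (φ.symm z.1) (fromMod φ z.1 (1, z.2.2)), z.2.1 ∘L toMod φ (φ.symm z.1)⟩
  source := {p | p.jet.pt ∈ φ.source}
  target := φ.target ×ˢ univ
  map_source' v hv := ⟨φ.map_source hv, mem_univ _⟩
  map_target' z hz := φ.map_target hz.1
  left_inv' := by
    rintro ⟨⟨x, u, hu⟩, a⟩ hx
    obtain ⟨y, hy, rfl⟩ : ∃ y ∈ φ.target, φ.symm y = x := ⟨φ x, φ.map_source hx, φ.left_inv hx⟩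
    have h2 : φ (φ.symm y) = y := φ.right_inv hy
    have h3 : (a ∘L fromMod φ y) ∘L toMod φ (φ.symm y) = a := by
      refine ContinuousLinearMap.ext fun w => ?_
      exact congrArg a (hφ.fromMod_toMod hy w)
    have h4 := (J1.chart φ hφ).left_inv (x := ⟨φ.symm y, u, hu⟩) hx
    change J1.ofVec π (φ.symm (φ (φ.symm y)))
      (fromMod φ (φ (φ.symm y)) (1, (toMod φ (φ.symm y) u).2)) = _ at h4
    dsimp only
    rw [hφ.toMod_inverse hy]
    rw [h2] at h4 ⊢
    exact mk_congr h4 (heq_of_eq h3)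
  right_inv' := by
    rintro ⟨y, a, w⟩ ⟨hy, -⟩
    have h := (J1.chart φ hφ).right_inv (x := (y, w)) ⟨hy, mem_univ _⟩
    have h1 : φ (φ.symm y) = y := congrArg Prod.fst h
    have h2 : (toMod φ (φ.symm y) (J1.ofVec π (φ.symm y) (fromMod φ y (1, w))).vel).2 = w :=
      congrArg Prod.snd h
    have h3 : (a ∘L toMod φ (φ.symm y)) ∘L (toMod φ (φ.symm y)).inverse = a := by
      rw [hφ.toMod_inverse hy]
      refine ContinuousLinearMap.ext fun w => ?_
      exact congrArg a (hφ.toMod_fromMod hy w)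
    exact Prod.ext h1 (Prod.ext h3 h2)

theorem chart_trans_source {φ ψ : OpenPartialHomeomorph E (EMod n)} (hφ : IsBundleChart π φ)
    (hψ : IsBundleChart π ψ) :
    ((chart φ hφ).symm.trans (chart ψ hψ)).source = (φ.symm ≫ₕ ψ).source ×ˢ univ := by
  ext ⟨y, w⟩
  change ((y ∈ φ.target ∧ w ∈ univ) ∧ φ.symm y ∈ ψ.source) ↔
    ((y ∈ φ.target ∧ φ.symm y ∈ ψ.source) ∧ w ∈ univ)
  tauto

theorem chart_trans_contDiffOn {φ ψ : OpenPartialHomeomorph E (EMod n)} (hφ : IsBundleChart π φ)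
    (hψ : IsBundleChart π ψ) :
    ContDiffOn ℝ ∞ ((chart φ hφ).symm.trans (chart ψ hψ))
      ((chart φ hφ).symm.trans (chart ψ hψ)).source := by
  rw [chart_trans_source]
  have hg := hφ.transition_contDiffOn hψ
  have hfst : ContDiffOn ℝ ∞ (fun z : PMod n => z.1) ((φ.symm ≫ₕ ψ).source ×ˢ univ) :=
    contDiff_fst.contDiffOn
  have hjet : ContDiffOn ℝ ∞ (fun z : PMod n => (z.1, z.2.2)) ((φ.symm ≫ₕ ψ).source ×ˢ univ) :=
    (contDiff_fst.prodMk (contDiff_snd.comp contDiff_snd)).contDiffOn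
  have hJ := J1.chart_trans_contDiffOn hφ hψ
  rw [J1.chart_trans_source] at hJ
  have h2 := hJ.comp hjet (fun z hz => ⟨hz.1, mem_univ _⟩)
  have hd := (hψ.transition_contDiffOn hφ).fderiv_of_isOpen (m := ∞)
    (ψ.symm ≫ₕ φ).open_source (by simp)
  have hmaps : ∀ y ∈ (φ.symm ≫ₕ ψ).source, ψ (φ.symm y) ∈ (ψ.symm ≫ₕ φ).source := by
    intro y hy
    simp only [OpenPartialHomeomorph.trans_source, OpenPartialHomeomorph.symm_source,
      mem_inter_iff, mem_preimage] at hy ⊢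
    exact ⟨ψ.map_source hy.2, by rw [ψ.left_inv hy.2]; exact φ.map_target hy.1⟩
  have h3 := hd.comp (hg.comp hfst (fun z hz => hz.1)) (fun z hz => hmaps _ hz.1)
  have hcov : ContDiffOn ℝ ∞ (fun z : PMod n => z.2.1) ((φ.symm ≫ₕ ψ).source ×ˢ univ) :=
    (contDiff_fst.comp contDiff_snd).contDiffOn
  have h4 := hcov.clm_comp h3
  refine ((contDiff_fst.comp_contDiffOn h2).prodMk
    (h4.prodMk (contDiff_snd.comp_contDiffOn h2))).congr ?_
  rintro ⟨y, a, w⟩ ⟨hy, -⟩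
  refine Prod.ext rfl (Prod.ext ?_ rfl)
  change (a ∘L toMod φ (φ.symm y)) ∘L (toMod ψ (φ.symm y)).inverse =
    a ∘L fderiv ℝ (φ ∘ ψ.symm) (ψ (φ.symm y))
  have hy2 := hmaps y hy
  have hy3 : φ.symm y ∈ ψ.source := by simp at hy; exact hy.2
  have hyt : ψ (φ.symm y) ∈ ψ.target := ψ.map_source hy3
  obtain ⟨y', hy', hyy⟩ : ∃ y' ∈ ψ.target, ψ.symm y' = φ.symm y :=
    ⟨_, hyt, ψ.left_inv hy3⟩
  rw [← hyy, ψ.right_inv hy', hψ.toMod_inverse hy']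
  rw [← hyy, ψ.right_inv hy'] at hy2
  refine ContinuousLinearMap.ext fun w => ?_
  exact congrArg a (hψ.toMod_fromMod_transition hφ hy2 w)

/-- The atlas of `T*E ×_E J¹π` formed by all natural charts. -/
def core (n : ℕ) {E : Type u} [TopologicalSpace E] [ChartedSpace (EMod n) E] (π : E → ℝ)
    [IsFibreBundle n π] : ChartedSpaceCore (PMod n) (Mixed n π) where
  atlas := {c | ∃ φ, ∃ hφ : IsBundleChart π φ, c = chart φ hφ}
  chartAt p := chart (exists_bundleChart π p.jet.pt).choose
    (exists_bundleChart π p.jet.pt).choose_spec.1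
  mem_chart_source p := (exists_bundleChart (n := n) π p.jet.pt).choose_spec.2
  chart_mem_atlas p := ⟨_, _, rfl⟩
  open_source := by
    rintro _ _ ⟨φ, hφ, rfl⟩ ⟨ψ, hψ, rfl⟩
    rw [chart_trans_source]
    exact (φ.symm ≫ₕ ψ).open_source.prod isOpen_univ
  continuousOn_toFun := by
    rintro _ _ ⟨φ, hφ, rfl⟩ ⟨ψ, hψ, rfl⟩
    exact (chart_trans_contDiffOn hφ hψ).continuousOn

instance : TopologicalSpace (Mixed n π) := (core n π).toTopologicalSpace
instance : ChartedSpace (PMod n) (Mixed n π) := (core n π).toChartedSpace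
instance : IsManifold 𝓘(ℝ, PMod n) ∞ (Mixed n π) :=
  isManifold_of_core _ (by
    rintro _ _ ⟨φ, hφ, rfl⟩ ⟨ψ, hψ, rfl⟩
    exact chart_trans_contDiffOn hφ hψ)

end Mixed

section Forms
variable {V : Type*} [NormedAddCommGroup V] [NormedSpace ℝ V] {H : Type*} [TopologicalSpace H]
  (I : ModelWithCorners ℝ V H) {M : Type*} [TopologicalSpace M] [ChartedSpace H M]

/-- `(α ∧ β)(u, w) = α(u) β(w) - α(w) β(u)`. -/
def wedge {x : M} (α β : TangentSpace I x →L[ℝ] ℝ) : LinearMap.BilinForm ℝ (TangentSpace I x) :=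
  LinearMap.mk₂ ℝ (fun u w => α u * β w - α w * β u)
    (fun u u' w => by simp only [map_add]; ring)
    (fun c u w => by simp only [map_smul, smul_eq_mul]; ring)
    (fun u w w' => by simp only [map_add]; ring)
    (fun c u w => by simp only [map_smul, smul_eq_mul]; ring)

/-- The local representative of a `1`-form in the preferred chart at `x`. -/
def localRep (θ : ∀ x : M, TangentSpace I x →L[ℝ] ℝ) (x : M) (y : V) : V →L[ℝ] ℝ :=
  θ ((extChartAt I x).symm y) ∘L mfderiv 𝓘(ℝ, V) I (extChartAt I x).symm y

/-- The exterior derivative of a `1`-form `θ` on a manifold without boundary, computed at `x` in the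
preferred chart at `x`: `dθ(u, w) = (D_u θ)(w) - (D_w θ)(u)`. -/
def dForm (θ : ∀ x : M, TangentSpace I x →L[ℝ] ℝ) (x : M) :
    LinearMap.BilinForm ℝ (TangentSpace I x) :=
  let A : V →L[ℝ] V →L[ℝ] ℝ := fderiv ℝ (localRep I θ x) (extChartAt I x x)
  let C : TangentSpace I x →L[ℝ] V := mvfderiv I (extChartAt I x) x
  LinearMap.mk₂ ℝ (fun u w => A (C u) (C w) - A (C w) (C u))
    (fun u u' w => by simp only [map_add, add_apply]; ring)
    (fun c u w => by
      simp only [map_smul, smul_apply, smul_eq_mul]; ring)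
    (fun u w w' => by simp only [map_add, add_apply]; ring)
    (fun c u w => by
      simp only [map_smul, smul_apply, smul_eq_mul]; ring)

variable {V' : Type*} [NormedAddCommGroup V'] [NormedSpace ℝ V'] {H' : Type*} [TopologicalSpace H']
  (I' : ModelWithCorners ℝ V' H') {M' : Type*} [TopologicalSpace M'] [ChartedSpace H' M']

/-- The pull-back `f^*Ω` of a field of bilinear forms. -/
def pullbackForm (f : M → M') (Ω : ∀ y : M', LinearMap.BilinForm ℝ (TangentSpace I' y)) (x : M) :
    LinearMap.BilinForm ℝ (TangentSpace I x) :=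
  (Ω (f x)).compl₁₂ (mfderiv I I' f x).toLinearMap (mfderiv I I' f x).toLinearMap
end Forms

section Cot
/-- The cotangent bundle `T*E`, with the manifold structure that Mathlib puts on the bundle
`Hom(TE, ℝ)`. -/
abbrev CotBundle (n : ℕ) (E : Type u) [TopologicalSpace E] [ChartedSpace (EMod n) E]
    [IsManifold 𝓘(ℝ, EMod n) ∞ E] : Type u :=
  Bundle.TotalSpace (EMod n →L[ℝ] ℝ)
    (fun x : E => TangentSpace 𝓘(ℝ, EMod n) x →L[ℝ] Bundle.Trivial E ℝ x)

/-- The model of `T*E`. -/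
abbrev ICot (n : ℕ) := 𝓘(ℝ, EMod n).prod 𝓘(ℝ, EMod n →L[ℝ] ℝ)

variable [IsManifold 𝓘(ℝ, EMod n) ∞ E]



/-- The Liouville `1`-form `τ dt + p_A dq^A` on `T*E`. -/
def liouville (α : CotBundle n E) : TangentSpace (ICot n) α →L[ℝ] ℝ :=
  α.2 ∘L mfderiv (ICot n) 𝓘(ℝ, EMod n) Bundle.TotalSpace.proj α

/-- The canonical symplectic form `ω_E = dq^A ∧ dp_A + dt ∧ dτ` on `T*E`. -/
def canonicalForm (α : CotBundle n E) : LinearMap.BilinForm ℝ (TangentSpace (ICot n) α) :=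
  -dForm (ICot n) liouville α

end Cot

section Lagrangian
set_option linter.unusedSectionVars false
variable [IsManifold 𝓘(ℝ, EMod n) ∞ E] {π : E → ℝ} [IsFibreBundle n π]

/-- The model of `J¹π`. -/
abbrev IJ (n : ℕ) := 𝓘(ℝ, EMod n × Fib n)
/-- The model of `T*E ×_E J¹π`. -/
abbrev IP (n : ℕ) := 𝓘(ℝ, PMod n)

/-- The projection `π_1 : J¹π → ℝ`. -/
def pi1 (v : J1 n π) : ℝ := π v.pt

/-- The `1`-form `π_1^* dt` on `J¹π`. -/
def etaJ (v : J1 n π) : TangentSpace (IJ n) v →L[ℝ] ℝ := mvfderiv (IJ n) pi1 v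

/-- The jet `v + (w - ⟨dt, w⟩ v)` over the base point of `v`. -/
def vshift (v : J1 n π) (w : TangentSpace 𝓘(ℝ, EMod n) v.pt) : J1 n π where
  pt := v.pt
  vel := v.vel + (w - mvfderiv 𝓘(ℝ, EMod n) π v.pt w • v.vel)
  dt_vel := by
    rw [map_add, map_sub, map_smul, v.dt_vel, smul_eq_mul, mul_one, sub_self, add_zero]

theorem vshift_zero (v : J1 n π) : vshift v 0 = v :=
  J1.mk_congr _ (by rw [map_zero, zero_smul, sub_zero, add_zero])

/-- The vertical lift to `v` of the vertical part `w - ⟨dt, w⟩ v` of `w ∈ T_{π_{1,0}(v)}E`, that is,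
the velocity at `s = 0` of the curve `s ↦ v + s (w - ⟨dt, w⟩ v)` (recall `vshift v 0 = v`). -/
def vlift (v : J1 n π) : TangentSpace 𝓘(ℝ, EMod n) v.pt →L[ℝ] TangentSpace (IJ n) v :=
  mfderiv 𝓘(ℝ, EMod n) (IJ n) (fun w : EMod n => vshift v w) 0

/-- The vertical endomorphism `S = (dq^A - q̇^A dt) ⊗ ∂/∂q̇^A` of `J¹π`. -/
def vertEndo (v : J1 n π) : TangentSpace (IJ n) v →L[ℝ] TangentSpace (IJ n) v :=
  vlift v ∘L mfderiv (IJ n) 𝓘(ℝ, EMod n) J1.pt v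

/-- The Poincaré–Cartan `1`-form `Θ_L = L π_1^*dt + S^*(dL)`. -/
def poincareCartan (L : J1 n π → ℝ) (v : J1 n π) : TangentSpace (IJ n) v →L[ℝ] ℝ :=
  L v • etaJ v + mvfderiv (IJ n) L v ∘L vertEndo v

/-- The Poincaré–Cartan `2`-form `ω_L = -dΘ_L`. -/
def omegaL (L : J1 n π → ℝ) (v : J1 n π) : LinearMap.BilinForm ℝ (TangentSpace (IJ n) v) :=
  -dForm (IJ n) (poincareCartan L) v

/-- `X` solves `i_X ω_L = 0`, `i_X (π_1^* dt) = 1` on `J¹π`. For a regular Lagrangian the unique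
solution is the Euler–Lagrange vector field `X_L`. -/
structure IsEulerLagrangeField (L : J1 n π → ℝ) (X : ∀ v : J1 n π, TangentSpace (IJ n) v) :
    Prop where
  omegaL_eq : ∀ v, omegaL L v (X v) = 0
  eta_eq : ∀ v, etaJ v (X v) = 1

/-- The covector `Leg_L(v)`; in coordinates `τ = L - q̇^A ∂L/∂q̇^A`, `p_A = ∂L/∂q̇^A`. It is
characterised by `legendreCov_apply` below. -/
def legendreCov (L : J1 n π → ℝ) (v : J1 n π) : TangentSpace 𝓘(ℝ, EMod n) v.pt →L[ℝ] ℝ :=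
  L v • mvfderiv 𝓘(ℝ, EMod n) π v.pt + mvfderiv (IJ n) L v ∘L vlift v

/-- The extended Legendre map `Leg_L : J¹π → T*E`. -/
def legendre (L : J1 n π → ℝ) (v : J1 n π) : CotBundle n E := ⟨v.pt, legendreCov L v⟩

/-- The projection `π_{1,0}` is smooth. -/
theorem contMDiff_pt : ContMDiff (IJ n) 𝓘(ℝ, EMod n) ∞ (J1.pt : J1 n π → E) := by
  intro v
  obtain ⟨φ, hφ, hc⟩ : ∃ φ : OpenPartialHomeomorph E (EMod n), ∃ hφ : IsBundleChart π φ,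
      (J1.core n π).chartAt v = J1.chart φ hφ := (J1.core n π).chart_mem_atlas v
  have hsrc : (chartAt (EMod n × Fib n) v).source = {w : J1 n π | w.pt ∈ φ.source} := by
    change ((J1.core n π).chartAt v).source = _
    rw [hc]; rfl
  have hfun : ∀ w : J1 n π, (chartAt (EMod n × Fib n) v w).1 = φ w.pt := by
    intro w
    change ((J1.core n π).chartAt v w).1 = _
    rw [hc]; rfl
  have hv : v.pt ∈ φ.source := by
    have := mem_chart_source (EMod n × Fib n) v
    rwa [hsrc] at this
  have h1 : ContMDiffAt (IJ n) (IJ n) ∞ (chartAt (EMod n × Fib n) v) v :=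
    (contMDiffOn_chart (I := IJ n)).contMDiffAt
      ((chartAt (EMod n × Fib n) v).open_source.mem_nhds (mem_chart_source _ v))
  have h2 : ContMDiffAt (IJ n) 𝓘(ℝ, EMod n) ∞
      (fun w => (chartAt (EMod n × Fib n) v w).1) v :=
    (contDiff_fst (𝕜 := ℝ) (E := EMod n) (F := Fib n)).contMDiff.contMDiffAt.comp v h1
  have h3 : ContMDiffAt 𝓘(ℝ, EMod n) 𝓘(ℝ, EMod n) ∞ φ.symm (chartAt (EMod n × Fib n) v v).1 := by
    rw [hfun]
    exact hφ.smooth_symm.contMDiffAt (φ.open_target.mem_nhds (φ.map_source hv))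
  refine (h3.comp v h2).congr_of_eventuallyEq ?_
  filter_upwards [(chartAt (EMod n × Fib n) v).open_source.mem_nhds (mem_chart_source _ v)]
    with w hw
  rw [hsrc] at hw
  simp only [Function.comp_apply, hfun]
  exact (φ.left_inv hw).symm

/-- `Leg_L(v)(w) = Θ_L(ξ)` for each `ξ ∈ T_v J¹π` that projects to `w ∈ TE`. -/
theorem legendreCov_apply (L : J1 n π → ℝ) (v : J1 n π) (ξ : TangentSpace (IJ n) v) :
    legendreCov L v (mfderiv (IJ n) 𝓘(ℝ, EMod n) J1.pt v ξ) = poincareCartan L v ξ := by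
  obtain ⟨φ, hφ, hx⟩ := exists_bundleChart (n := n) π v.pt
  have hπ : MDifferentiableAt 𝓘(ℝ, EMod n) 𝓘(ℝ, ℝ) π v.pt := by
    have h1 : (fun z => (φ z).1) =ᶠ[𝓝 v.pt] π :=
      Filter.eventuallyEq_of_mem (φ.open_source.mem_nhds hx) hφ.fst_eq
    refine MDifferentiableAt.congr_of_eventuallyEq ?_ h1.symm
    exact ((ContinuousLinearMap.fst ℝ ℝ (Fib n)).mdifferentiableAt (x := φ v.pt)).comp v.pt
      (hφ.mdiff.mdifferentiableAt hx)
  have h := mfderiv_comp v hπ ((contMDiff_pt (n := n) (π := π) v).mdifferentiableAt (by simp))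
  have h' : etaJ v ξ = mvfderiv 𝓘(ℝ, EMod n) π v.pt (mfderiv (IJ n) 𝓘(ℝ, EMod n) J1.pt v ξ) :=
    DFunLike.congr_fun h ξ
  change L v * _ + _ = L v * etaJ v ξ + _
  rw [h']
  rfl

/-- The matrix `∂²L/∂q̇^A∂q̇^B` at the jet `v` in a natural chart. -/
def hessian (L : J1 n π → ℝ) (φ : OpenPartialHomeomorph E (EMod n)) (hφ : IsBundleChart π φ)
    (v : J1 n π) : Matrix (Fin n) (Fin n) ℝ :=
  Matrix.of fun A B =>
    fderiv ℝ (fun w => fderiv ℝ (fun w' => L ((J1.chart φ hφ).symm (φ v.pt, w'))) w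
      (EuclideanSpace.single B 1)) (J1.chart φ hφ v).2 (EuclideanSpace.single A 1)

/-- `L` is regular: its Hessian with respect to the velocities is everywhere non-singular. -/
def IsRegular (L : J1 n π → ℝ) : Prop :=
  ∀ (φ : OpenPartialHomeomorph E (EMod n)) (hφ : IsBundleChart π φ) (v : J1 n π),
    v.pt ∈ φ.source → (hessian L φ hφ v).det ≠ 0

/-- The projection onto `T*E`. -/
def pr1 (p : Mixed n π) : CotBundle n E := ⟨p.jet.pt, p.cov⟩
/-- The projection onto `J¹π`. -/
def pr2 (p : Mixed n π) : J1 n π := p.jet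

/-- The `1`-form `η = (π ∘ pr)^* dt` on `T*E ×_E J¹π`. -/
def eta (p : Mixed n π) : TangentSpace (IP n) p →L[ℝ] ℝ := mvfderiv (IP n) (fun q => π (pr1 q).proj) p

/-- The function `⟨pr_1, j ∘ pr_2⟩ - pr_2^* L`, in coordinates `p_A q̇^A + τ - L`. -/
def energy (L : J1 n π → ℝ) (p : Mixed n π) : ℝ := p.cov p.jet.vel - L (pr2 p)

/-- The `2`-form `ω_H = pr_1^* ω_E + dH ∧ η`. -/
def omegaH (L : J1 n π → ℝ) (p : Mixed n π) : LinearMap.BilinForm ℝ (TangentSpace (IP n) p) :=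
  pullbackForm (IP n) (ICot n) pr1 canonicalForm p + wedge (IP n) (mvfderiv (IP n) (energy L) p) (eta p)

/-- The map `Leg_L ×_E id : J¹π → T*E ×_E J¹π`. -/
def graphMap (L : J1 n π → ℝ) (v : J1 n π) : Mixed n π := ⟨v, legendreCov L v⟩

theorem pr1_graphMap (L : J1 n π → ℝ) (v : J1 n π) : pr1 (graphMap L v) = legendre L v := rfl

/-- The graph of `Leg_L`. -/
def graphL (L : J1 n π → ℝ) : Set (Mixed n π) := range (graphMap L)

/-- `Z`, a field of tangent vectors of `T*E ×_E J¹π` defined at the points of `graph_L`, solves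
`i_Z ω_H = 0`, `i_Z η = 1` there and is tangent to `graph_L`. The tangent space of `graph_L` is the
image of the differential of its parametrisation `Leg_L ×_E id`. -/
structure IsSRSolution (L : J1 n π → ℝ) (Z : ∀ p : graphL L, TangentSpace (IP n) p.1) : Prop where
  omegaH_eq : ∀ p, omegaH L p.1 (Z p) = 0
  eta_eq : ∀ p, eta p.1 (Z p) = 1
  tangent : ∀ v : J1 n π, Z ⟨graphMap L v, v, rfl⟩ ∈ (mfderiv (IJ n) (IP n) (graphMap L) v).range

/-- Smoothness of a vector field on `J¹π`. -/
def IsSmoothField (X : ∀ v : J1 n π, TangentSpace (IJ n) v) : Prop :=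
  ContMDiff (IJ n) (IJ n).tangent ∞ (fun v => (⟨v, X v⟩ : TangentBundle (IJ n) (J1 n π)))

/-- Smoothness of a vector field defined along `graph_L`, in the parametrisation of `graph_L` by
`Leg_L ×_E id : J¹π → graph_L` (whose inverse is the restriction of `pr_2`). -/
def IsSmoothAlong (L : J1 n π → ℝ) (Z : ∀ p : graphL L, TangentSpace (IP n) p.1) : Prop :=
  ContMDiff (IJ n) (IP n).tangent ∞
    (fun v => (⟨graphMap L v, Z ⟨graphMap L v, v, rfl⟩⟩ : TangentBundle (IP n) (Mixed n π)))
end Lagrangian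
end
end SkinnerRusk
end

/-! In natural coordinates `Θ_L = l dt + (∂l/∂q̇)(dq - q̇ dt)`. Let `dt(X) = 1`. Contracting `dΘ_L`
with `X` and a velocity direction gives the velocity Hessian applied to `(q-part of X) - q̇`, so
regularity forces `X` to be of second order. Contracting with a `q`-direction then gives `Hess · a =
force` for the acceleration `a`, which has a unique solution, smooth in the base point. Contractions
with the remaining directions vanish automatically. This is `eq_coordField_iff`, carried over to
`J¹π` by `eulerLagrange_iff`.

For the second half let `g = Leg_L ×_E id`, a section of `pr2`. The energy vanishes on the graph,
and `Leg_L` pulls the Liouville form back to `Θ_L`; hence `g^*ω_H = ω_L` (`omegaH_graphMap`). A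
solution tangent to the graph is therefore `g_*Y` with `Y` a solution on `J¹π`, which gives
uniqueness and relatedness.

For existence, `i_Z ω_H = 0` must be tested on all vectors at points of the graph. These split into
vectors tangent to the graph and vectors in the kernel of `pr2_*`, the momentum directions. On the
latter the equation holds because `X_L` is of second order (`omegaH_apply_of_mfderiv_pr2_eq_zero`).
So `Z = g_*X_L` is the solution, and its smoothness follows from that of `g` and `X_L`. -/

noncomputable section
namespace SkinnerRusk
universe u

/-! ### Exterior derivative of a 1-form along a parametrisation by a vector space. -/

section ExteriorDerivative
variable {V : Type*} [NormedAddCommGroup V] [NormedSpace ℝ V] {H : Type*} [TopologicalSpace H]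
  {I : ModelWithCorners ℝ V H} [I.Boundaryless] {M : Type*} [TopologicalSpace M] [ChartedSpace H M]
  [IsManifold I ∞ M] {W : Type*} [NormedAddCommGroup W] [NormedSpace ℝ W]

/-- The exterior derivative of `θ`, evaluated on vectors pushed forward from a vector space along `f`,
is the antisymmetrised derivative of `f^*θ`. -/
theorem dForm_mfderiv {θ : ∀ x : M, TangentSpace I x →L[ℝ] ℝ} {f : W → M} {z : W}
    (hf : ContMDiffAt 𝓘(ℝ, W) I ∞ f z)
    (hθ : DifferentiableAt ℝ (localRep I θ (f z)) (extChartAt I (f z) (f z)))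
    {T : W → W →L[ℝ] ℝ}
    (hT : ∀ᶠ z' in 𝓝 z, ∀ u : W, T z' u = θ (f z') (mfderiv 𝓘(ℝ, W) I f z' u)) (u w : W) :
    dForm I θ (f z) (mfderiv 𝓘(ℝ, W) I f z u) (mfderiv 𝓘(ℝ, W) I f z w) =
      fderiv ℝ T z u w - fderiv ℝ T z w u := by
  have : IsManifold I 1 M := IsManifold.of_le (n := ∞) (by simp)
  set e := extChartAt I (f z) with he
  set F : W → V := fun z' => e (f z') with hFdef
  have hF : ContDiffAt ℝ ∞ F z := by
    rw [← contMDiffAt_iff_contDiffAt]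
    exact (contMDiffAt_extChartAt (I := I) (n := ∞) (x := f z)).comp z hf
  have hsrc : ∀ᶠ z' in 𝓝 z, f z' ∈ e.source :=
    hf.continuousAt.preimage_mem_nhds (extChartAt_source_mem_nhds (I := I) (f z))
  -- The factorisation through the chart is needed near every nearby `z'`, since it is the
  -- derivative of `f` at `z'`, as a function of `z'`, that gets differentiated.
  have hfF : ∀ᶠ z' in 𝓝 z, f =ᶠ[𝓝 z'] fun y => e.symm (F y) := by
    refine (eventually_eventually_nhds.2 hsrc).mono fun z' h => h.mono fun y hy => ?_
    exact (e.left_inv hy).symm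
  have hsm : ∀ᶠ z' in 𝓝 z, ContDiffAt ℝ 1 F z' :=
    (hF.of_le (by simp : (1 : ℕ∞ω) ≤ ∞)).eventually (by simp)
  have hder : ∀ᶠ z' in 𝓝 z, mfderiv 𝓘(ℝ, W) I f z' =
      (mfderiv 𝓘(ℝ, V) I e.symm (F z')).comp (fderiv ℝ F z') := by
    filter_upwards [hfF, hsrc, hsm] with z' h1 h2 h3
    have hy : F z' ∈ e.target := e.map_source h2
    have h4 : MDifferentiableAt 𝓘(ℝ, V) I e.symm (F z') :=
      ((contMDiffOn_extChartAt_symm (n := 1) (f z)).contMDiffAt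
        ((isOpen_extChartAt_target (I := I) (f z)).mem_nhds hy)).mdifferentiableAt (by simp)
    have h5 : MDifferentiableAt 𝓘(ℝ, W) 𝓘(ℝ, V) F z' :=
      (h3.differentiableAt (by simp)).mdifferentiableAt
    have h6 := mfderiv_comp z' h4 h5
    rw [mfderiv_eq_fderiv] at h6
    exact h1.mfderiv_eq.trans h6
  have hTF : T =ᶠ[𝓝 z] fun z' => (localRep I θ (f z) (F z')).comp (fderiv ℝ F z') := by
    filter_upwards [hT, hder, hsrc] with z' h1 h2 h3
    have h4 : e.symm (F z') = f z' := e.left_inv h3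
    refine ContinuousLinearMap.ext fun u => ?_
    rw [h1, h2]
    change _ = θ (e.symm (F z')) (mfderiv 𝓘(ℝ, V) I e.symm (F z') (fderiv ℝ F z' u))
    rw [h4]
    rfl
  have hDF : HasFDerivAt (fderiv ℝ F) (fderiv ℝ (fderiv ℝ F) z) z :=
    ((hF.fderiv_right (m := ∞) (by simp)).differentiableAt (by simp)).hasFDerivAt
  have hDT := ((hθ.hasFDerivAt (x := F z)).comp z
    (hF.differentiableAt (by simp)).hasFDerivAt).clm_comp hDF
  -- By the product rule the derivative of `T` has a term containing the second derivative of `F`.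
  -- It is symmetric in `u, w` and drops out of the antisymmetrisation; what remains is `dForm` in
  -- the preferred chart.
  have hsymm := (hF.isSymmSndFDerivAt (by simp; exact WithTop.coe_le_coe.2 le_top)) u w
  have hC : ∀ u : W, mvfderiv I e (f z) (mfderiv 𝓘(ℝ, W) I f z u) = fderiv ℝ F z u := by
    intro u
    have h := mfderiv_comp z (mdifferentiableAt_extChartAt (I := I) (mem_chart_source H (f z)))
      (hf.mdifferentiableAt (by simp))
    have h' : fderiv ℝ F z = _ := (mfderiv_eq_fderiv (f := F) (x := z)).symm.trans h
    rw [h']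
    rfl
  change fderiv ℝ (localRep I θ (f z)) (e (f z)) (mvfderiv I e (f z) _) (mvfderiv I e (f z) _) -
    fderiv ℝ (localRep I θ (f z)) (e (f z)) (mvfderiv I e (f z) _) (mvfderiv I e (f z) _) = _
  rw [hC, hC, hTF.fderiv_eq]
  have hDT' := hDT.fderiv
  simp only [Function.comp_def] at hDT'
  rw [hDT']
  simp [hsymm, F]

end ExteriorDerivative

/-! ### The Poincaré–Cartan form on coordinate space. -/

section Coordinates
variable {n : ℕ}

/-- The vertical endomorphism in natural coordinates. -/
def coordEndo (z : EMod n × Fib n) : (EMod n × Fib n) →L[ℝ] (EMod n × Fib n) :=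
  (ContinuousLinearMap.inr ℝ (EMod n) (Fib n)).comp
    (((ContinuousLinearMap.snd ℝ ℝ (Fib n)) -
      (ContinuousLinearMap.fst ℝ ℝ (Fib n)).smulRight z.2).comp
        (ContinuousLinearMap.fst ℝ (EMod n) (Fib n)))

/-- The form `dt` in natural coordinates. -/
def coordDt : (EMod n × Fib n) →L[ℝ] ℝ :=
  (ContinuousLinearMap.fst ℝ ℝ (Fib n)).comp (ContinuousLinearMap.fst ℝ (EMod n) (Fib n))

@[simp] theorem coordEndo_apply (z u : EMod n × Fib n) :
    coordEndo z u = (0, u.1.2 - u.1.1 • z.2) := rfl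

@[simp] theorem coordDt_apply (u : EMod n × Fib n) : coordDt u = u.1.1 := rfl

/-- The Poincaré–Cartan form `l dt + ∂l/∂q̇ (dq - q̇ dt)` in natural coordinates. -/
def coordTheta (l : EMod n × Fib n → ℝ) (z : EMod n × Fib n) : (EMod n × Fib n) →L[ℝ] ℝ :=
  l z • coordDt + (fderiv ℝ l z).comp (coordEndo z)

theorem coordTheta_apply (l : EMod n × Fib n → ℝ) (z u : EMod n × Fib n) :
    coordTheta l z u = l z * u.1.1 + fderiv ℝ l z (0, u.1.2 - u.1.1 • z.2) := rfl

theorem contDiff_coordEndo : ContDiff ℝ ∞ (coordEndo (n := n)) := by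
  unfold coordEndo
  refine contDiff_const.clm_comp ((contDiff_const.sub ?_).clm_comp contDiff_const)
  exact contDiff_const.smulRight contDiff_snd

theorem contDiffAt_coordTheta {l : EMod n × Fib n → ℝ} {z : EMod n × Fib n}
    (hl : ContDiffAt ℝ ∞ l z) : ContDiffAt ℝ ∞ (coordTheta l) z :=
  (hl.smul contDiffAt_const).add
    ((hl.fderiv_right (m := ∞) (by simp)).clm_comp contDiff_coordEndo.contDiffAt)

/-- Product rule. For fixed `w`, `coordEndo z w` is affine in `z` with derivative `u ↦ (0, -w.1.1 •
u.2)`, which accounts for the last term. -/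
theorem fderiv_coordTheta {l : EMod n × Fib n → ℝ} {z : EMod n × Fib n}
    (hl : ContDiffAt ℝ ∞ l z) (u w : EMod n × Fib n) :
    fderiv ℝ (coordTheta l) z u w = fderiv ℝ l z u * w.1.1 +
      fderiv ℝ (fderiv ℝ l) z u (0, w.1.2 - w.1.1 • z.2) - w.1.1 * fderiv ℝ l z (0, u.2) := by
  have hd := (hl.fderiv_right (m := ∞) (by simp)).differentiableAt (by simp)
  have hlz := (hl.differentiableAt (by simp)).hasFDerivAt
  have h1 : HasFDerivAt (fun z' => coordTheta l z' w) ((fderiv ℝ (coordTheta l) z).flip w) z := by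
    have := ((contDiffAt_coordTheta hl).differentiableAt (by simp)).hasFDerivAt
    simpa using this.clm_apply (hasFDerivAt_const w z)
  have hc : HasFDerivAt (fun z' : EMod n × Fib n => coordEndo z' w)
      (-(w.1.1 • (ContinuousLinearMap.inr ℝ (EMod n) (Fib n)).comp
        (ContinuousLinearMap.snd ℝ (EMod n) (Fib n)))) z := by
    have h : (fun z' : EMod n × Fib n => coordEndo z' w) = fun z' => (0, w.1.2) +
        (-(w.1.1 • (ContinuousLinearMap.inr ℝ (EMod n) (Fib n)).comp
        (ContinuousLinearMap.snd ℝ (EMod n) (Fib n)))) z' := by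
      funext z'
      simp [sub_eq_add_neg]
    rw [h]
    exact (ContinuousLinearMap.hasFDerivAt _).const_add _
  have h2 := (hlz.mul_const w.1.1).add (hd.hasFDerivAt.clm_apply hc)
  have h3 := DFunLike.congr_fun (h1.unique h2) u
  simp at h3
  rw [h3]
  ring_nf

end Coordinates

/-! ### The Euler–Lagrange field on coordinate space. -/

section CoordinateField
variable {n : ℕ}

/-- Restriction of a covector to the velocity directions. -/
def velRestrict : ((EMod n × Fib n) →L[ℝ] ℝ) →L[ℝ] Fib n →L[ℝ] ℝ :=
  (ContinuousLinearMap.compL ℝ (Fib n) (EMod n × Fib n) ℝ).flip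
    (ContinuousLinearMap.inr ℝ (EMod n) (Fib n))

/-- The Hessian of `l` with respect to the velocities. -/
def velHessian (l : EMod n × Fib n → ℝ) (z : EMod n × Fib n) : Fib n →L[ℝ] Fib n →L[ℝ] ℝ :=
  velRestrict.comp ((fderiv ℝ (fderiv ℝ l) z).comp (ContinuousLinearMap.inr ℝ (EMod n) (Fib n)))

@[simp] theorem velHessian_apply (l : EMod n × Fib n → ℝ) (z : EMod n × Fib n) (c d : Fib n) :
    velHessian l z c d = fderiv ℝ (fderiv ℝ l) z (0, c) (0, d) := rfl

/-- The generalised force `∂l/∂q - (∂_t + q̇ ∂_q) ∂l/∂q̇`. -/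
def coordForce (l : EMod n × Fib n → ℝ) (z : EMod n × Fib n) : Fib n →L[ℝ] ℝ :=
  (fderiv ℝ l z).comp ((ContinuousLinearMap.inl ℝ (EMod n) (Fib n)).comp
    (ContinuousLinearMap.inr ℝ ℝ (Fib n))) -
    velRestrict (fderiv ℝ (fderiv ℝ l) z ((1, z.2), 0))

@[simp] theorem coordForce_apply (l : EMod n × Fib n → ℝ) (z : EMod n × Fib n) (d : Fib n) :
    coordForce l z d = fderiv ℝ l z ((0, d), 0) -
      fderiv ℝ (fderiv ℝ l) z ((1, z.2), 0) (0, d) := rfl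

/-- The Euler–Lagrange vector field `∂_t + q̇ ∂_q + a ∂_q̇` in natural coordinates. -/
def coordField (l : EMod n × Fib n → ℝ) (z : EMod n × Fib n) : EMod n × Fib n :=
  ((1, z.2), (velHessian l z).inverse (coordForce l z))

/-- An injective velocity Hessian is an isomorphism onto the dual. -/
theorem exists_equiv_of_injective {B : Fib n →L[ℝ] Fib n →L[ℝ] ℝ} (hB : ∀ d, B d = 0 → d = 0) :
    ∃ e : Fib n ≃L[ℝ] (Fib n →L[ℝ] ℝ), (e : Fib n →L[ℝ] Fib n →L[ℝ] ℝ) = B := by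
  have hfin : Module.finrank ℝ (Fib n) = Module.finrank ℝ (Fib n →L[ℝ] ℝ) :=
    (InnerProductSpace.toDual ℝ (Fib n)).toLinearEquiv.finrank_eq
  have hinj : Function.Injective B.toLinearMap :=
    (injective_iff_map_eq_zero B.toLinearMap).2 hB
  refine ⟨(LinearEquiv.ofInjectiveOfFinrankEq B.toLinearMap hinj hfin).toContinuousLinearEquiv, ?_⟩
  ext1 d
  rfl

variable {l : EMod n × Fib n → ℝ} {z : EMod n × Fib n}

/-- Injectivity at `z` alone suffices, because operator inversion is smooth at every isomorphism. -/
theorem contDiffAt_coordField (hl : ContDiffAt ℝ ∞ l z) (hH : ∀ d, velHessian l z d = 0 → d = 0) :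
    ContDiffAt ℝ ∞ (coordField l) z := by
  have hd := hl.fderiv_right (m := ∞) (by simp)
  have hdd := hd.fderiv_right (m := ∞) (by simp)
  have h1 : ContDiffAt ℝ ∞ (velHessian l) z :=
    contDiffAt_const.clm_comp (hdd.clm_comp contDiffAt_const)
  have hv : ContDiffAt ℝ ∞ (fun z : EMod n × Fib n => ((1 : ℝ), z.2)) z :=
    contDiffAt_const.prodMk contDiffAt_snd
  have h2 : ContDiffAt ℝ ∞ (coordForce l) z :=
    (hd.clm_comp contDiffAt_const).sub
      (contDiffAt_const.clm_apply (hdd.clm_apply (hv.prodMk contDiffAt_const)))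
  obtain ⟨e, he⟩ := exists_equiv_of_injective hH
  have h3 : ContDiffAt ℝ ∞ ContinuousLinearMap.inverse (velHessian l z) := by
    rw [← he]
    exact contDiffAt_map_inverse e
  exact hv.prodMk ((h3.comp z h1).clm_apply h2)

/-- In natural coordinates, `i_X dθ = 0` and `dt(X) = 1` characterise the Euler–Lagrange field. -/
theorem eq_coordField_iff (hl : ContDiffAt ℝ ∞ l z) (hH : ∀ d, velHessian l z d = 0 → d = 0)
    (X : EMod n × Fib n) :
    ((∀ W, fderiv ℝ (coordTheta l) z X W - fderiv ℝ (coordTheta l) z W X = 0) ∧ X.1.1 = 1) ↔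
      X = coordField l z := by
  have hsymm : ∀ u w, fderiv ℝ (fderiv ℝ l) z u w = fderiv ℝ (fderiv ℝ l) z w u :=
    fun u w => (hl.isSymmSndFDerivAt (by simp; exact WithTop.coe_le_coe.2 le_top)) u w
  obtain ⟨e, he⟩ := exists_equiv_of_injective hH
  have hinv : (velHessian l z).inverse = (e.symm : (Fib n →L[ℝ] ℝ) →L[ℝ] Fib n) := by
    rw [← he, ContinuousLinearMap.inverse_equiv]
  have hea : ∀ c, e c = velHessian l z c := fun c => DFunLike.congr_fun he c
  -- The right-hand side is the Euler–Lagrange equation `(∂_t + q̇ ∂_q + a ∂_q̇)(∂l/∂q̇) = ∂l/∂q`,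
  -- solved for the acceleration `a`.
  have key : ∀ a : Fib n, a = (velHessian l z).inverse (coordForce l z) ↔
      ∀ d, fderiv ℝ (fderiv ℝ l) z ((1, z.2), a) (0, d) = fderiv ℝ l z ((0, d), 0) := by
    intro a
    rw [hinv]
    change a = e.symm _ ↔ _
    rw [e.eq_symm_apply, hea, ContinuousLinearMap.ext_iff]
    refine forall_congr' fun d => ?_
    have : (((1 : ℝ), z.2), a) = (((1 : ℝ), z.2), (0 : Fib n)) + (0, a) := by simp
    rw [this, map_add, add_apply, velHessian_apply, coordForce_apply]
    constructor <;> intro h <;> linarith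
  constructor
  · rintro ⟨h, ht⟩
    obtain ⟨⟨t, q⟩, a⟩ := X
    obtain rfl : t = 1 := ht
    have hq : q = z.2 := by
      have : q - z.2 = 0 := by
        apply hH
        ext1 d
        -- Against a velocity direction the first-order terms cancel and only the Hessian of `q -
        -- q̇` and `d` survives.
        have := h (0, d)
        rw [fderiv_coordTheta hl, fderiv_coordTheta hl] at this
        simp at this
        have h1 : fderiv ℝ (fderiv ℝ l) z ((1, q), a) (0, 0) = 0 := map_zero _
        rw [h1, zero_sub, neg_eq_zero] at this
        rw [velHessian_apply, hsymm, this]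
        rfl
      exact sub_eq_zero.1 this
    subst hq
    refine Prod.ext rfl ((key a).2 fun d => ?_)
    -- Against a `q`-direction the condition is the Euler–Lagrange equation of `key`.
    have := h ((0, d), 0)
    rw [fderiv_coordTheta hl, fderiv_coordTheta hl] at this
    simp at this
    have h0 : fderiv ℝ l z (0, 0) = 0 := map_zero _
    have h1 : fderiv ℝ (fderiv ℝ l) z ((0, d), 0) (0, 0) = 0 := map_zero _
    linarith
  · rintro rfl
    refine ⟨fun W => ?_, rfl⟩
    have hk := (key _).1 rfl
    obtain ⟨⟨s, d⟩, c⟩ := W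
    set a := (velHessian l z).inverse (coordForce l z) with ha
    have hX : coordField l z = ((1, z.2), a) := rfl
    rw [hX, fderiv_coordTheta hl, fderiv_coordTheta hl]
    have h0 := hk (d - s • z.2)
    -- The test vector is split into a multiple of the field, a `q`-direction, to which the equation
    -- `h0` applies, and a velocity direction. Linearity of `fderiv ℝ l z` on this splitting makes
    -- all terms cancel.
    have h1 : (((s, d), c) : EMod n × Fib n) =
        s • ((1, z.2), a) + ((0, d - s • z.2), 0) + (0, c - s • a) := by
      ext <;> simp
    have h2 : (((1 : ℝ), z.2), a) = (((1 : ℝ), z.2), (0 : Fib n)) + (0, a) := by simp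
    have h3 : fderiv ℝ l z (0, c - s • a) = fderiv ℝ l z (0, c) - s * fderiv ℝ l z (0, a) := by
      have : ((0, c - s • a) : EMod n × Fib n) = (0, c) - s • (0, a) := by simp
      rw [this, map_sub, map_smul, smul_eq_mul]
    have h4 : fderiv ℝ l z ((s, d), c) = s * fderiv ℝ l z ((1, z.2), a) +
        fderiv ℝ l z ((0, d - s • z.2), 0) + fderiv ℝ l z (0, c - s • a) := by
      rw [h1, map_add, map_add, map_smul, smul_eq_mul]
    have h5 : fderiv ℝ (fderiv ℝ l) z ((s, d), c) (0, 0) = 0 := map_zero _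
    simp only [one_smul, sub_self, h5]
    rw [h0, h4, h3]
    ring

end CoordinateField

/-! ### Natural coordinates on `J¹π`: the Poincaré–Cartan forms and the Euler–Lagrange equation. -/

section JetCoordinates
set_option linter.unusedSectionVars false
variable {n : ℕ} {E : Type u} [TopologicalSpace E] [ChartedSpace (EMod n) E]
  [IsManifold 𝓘(ℝ, EMod n) ∞ E] {π : E → ℝ} [IsFibreBundle n π]
  {φ : OpenPartialHomeomorph E (EMod n)} (hφ : IsBundleChart π φ)

/-- A natural chart of `J¹π` as an open partial homeomorphism. -/
def J1.natChart : OpenPartialHomeomorph (J1 n π) (EMod n × Fib n) :=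
  (J1.core n π).openPartialHomeomorph (J1.chart φ hφ) ⟨φ, hφ, rfl⟩

theorem J1.natChart_mem_atlas : J1.natChart hφ ∈ atlas (EMod n × Fib n) (J1 n π) := by
  change _ ∈ ⋃ (f : PartialEquiv (J1 n π) (EMod n × Fib n)) (hf : f ∈ (J1.core n π).atlas),
    {(J1.core n π).openPartialHomeomorph f hf}
  simp only [mem_iUnion, mem_singleton_iff]
  exact ⟨J1.chart φ hφ, ⟨φ, hφ, rfl⟩, rfl⟩

theorem J1.exists_chartAt_eq (v : J1 n π) :
    ∃ (φ : OpenPartialHomeomorph E (EMod n)) (hφ : IsBundleChart π φ), v.pt ∈ φ.source ∧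
      chartAt (EMod n × Fib n) v = J1.natChart hφ :=
  ⟨_, (exists_bundleChart π v.pt).choose_spec.1, (exists_bundleChart π v.pt).choose_spec.2, rfl⟩

theorem J1.contMDiffOn_natChart :
    ContMDiffOn (IJ n) (IJ n) ∞ (J1.natChart hφ) (J1.natChart hφ).source :=
  contMDiffOn_of_mem_maximalAtlas
    (IsManifold.subset_maximalAtlas (J1.natChart_mem_atlas hφ))

theorem J1.contMDiffOn_natChart_symm :
    ContMDiffOn (IJ n) (IJ n) ∞ (J1.natChart hφ).symm (J1.natChart hφ).target :=
  contMDiffOn_symm_of_mem_maximalAtlas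
    (IsManifold.subset_maximalAtlas (J1.natChart_mem_atlas hφ))

theorem J1.mdifferentiable_natChart : (J1.natChart hφ).MDifferentiable (IJ n) (IJ n) :=
  ⟨(J1.contMDiffOn_natChart hφ).mdifferentiableOn (by simp),
    (J1.contMDiffOn_natChart_symm hφ).mdifferentiableOn (by simp)⟩

theorem J1.natChart_symm_vel {z : EMod n × Fib n} (hz : z ∈ (J1.natChart hφ).target) :
    ((J1.natChart hφ).symm z).vel = fromMod φ z.1 (1, z.2) :=
  J1.ofVec_fromMod hφ hz.1 z.2

/-- The coordinate vector `u` at `z`, as a tangent vector of `J¹π`. -/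
def J1.ofCoord (z : EMod n × Fib n) : (EMod n × Fib n) →L[ℝ]
    TangentSpace (IJ n) ((J1.natChart hφ).symm z) :=
  mfderiv (IJ n) (IJ n) (J1.natChart hφ).symm z

variable {z : EMod n × Fib n} (hz : z ∈ (J1.natChart hφ).target)
include hz

theorem J1.contMDiffAt_natChart_symm : ContMDiffAt (IJ n) (IJ n) ∞ (J1.natChart hφ).symm z :=
  (J1.contMDiffOn_natChart_symm hφ).contMDiffAt ((J1.natChart hφ).open_target.mem_nhds hz)

theorem J1.ofCoord_bijective : Function.Bijective (J1.ofCoord hφ z) := by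
  have h := (J1.mdifferentiable_natChart hφ).symm.mfderiv_bijective hz
  exact h

theorem J1.mfderiv_pt_ofCoord (u : EMod n × Fib n) :
    mfderiv (IJ n) 𝓘(ℝ, EMod n) J1.pt ((J1.natChart hφ).symm z) (J1.ofCoord hφ z u) =
      fromMod φ z.1 u.1 := by
  have h1 := mfderiv_comp (I := IJ n) (I' := IJ n) (I'' := 𝓘(ℝ, EMod n)) z
    (g := (J1.pt : J1 n π → E)) (f := (J1.natChart hφ).symm)
    (contMDiff_pt.mdifferentiableAt (by simp))
    ((J1.contMDiffAt_natChart_symm hφ hz).mdifferentiableAt (by simp))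
  have h2 := mfderiv_comp (I := IJ n) (I' := 𝓘(ℝ, EMod n)) (I'' := 𝓘(ℝ, EMod n)) z
    (g := φ.symm) (f := Prod.fst)
    (hφ.mdiff.symm.mdifferentiableAt hz.1)
    (ContinuousLinearMap.fst ℝ (EMod n) (Fib n)).mdifferentiableAt
  have h4 : mfderiv (IJ n) 𝓘(ℝ, EMod n) (Prod.fst : EMod n × Fib n → EMod n) z
      = ContinuousLinearMap.fst ℝ (EMod n) (Fib n) :=
    (ContinuousLinearMap.fst ℝ (EMod n) (Fib n)).hasMFDerivAt.mfderiv
  rw [h4] at h2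
  exact DFunLike.congr_fun (h1.symm.trans h2) u

theorem etaJ_ofCoord (u : EMod n × Fib n) :
    etaJ ((J1.natChart hφ).symm z) (J1.ofCoord hφ z u) = u.1.1 := by
  have hd : MDifferentiableAt (IJ n) 𝓘(ℝ, ℝ) (fun v : J1 n π => (φ v.pt).1)
      ((J1.natChart hφ).symm z) :=
    ((ContinuousLinearMap.fst ℝ ℝ (Fib n)).mdifferentiableAt).comp _
      ((hφ.mdiff.mdifferentiableAt (φ.map_target hz.1)).comp ((J1.natChart hφ).symm z)
      (contMDiff_pt.mdifferentiableAt (by simp)))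
  have he : pi1 =ᶠ[𝓝 ((J1.natChart hφ).symm z)] (fun v : J1 n π => (φ v.pt).1) := by
    filter_upwards [(J1.natChart hφ).open_source.mem_nhds ((J1.natChart hφ).map_target hz)]
      with v hv
    exact (hφ.fst_eq _ hv).symm
  have hd' : MDifferentiableAt (IJ n) 𝓘(ℝ, ℝ) (pi1 (n := n) (π := π))
      ((J1.natChart hφ).symm z) := hd.congr_of_eventuallyEq he
  have h1 := mfderiv_comp (I := IJ n) (I' := IJ n) (I'' := 𝓘(ℝ, ℝ)) z hd'
    ((J1.contMDiffAt_natChart_symm hφ hz).mdifferentiableAt (by simp))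
  have h2 : (pi1 ∘ (J1.natChart hφ).symm) =ᶠ[𝓝 z] coordDt := by
    filter_upwards [(J1.natChart hφ).open_target.mem_nhds hz] with y hy
    change π (φ.symm y.1) = y.1.1
    rw [← hφ.fst_eq _ (φ.map_target hy.1), φ.right_inv hy.1]
  have h3 := h2.mfderiv_eq (I := IJ n) (I' := 𝓘(ℝ, ℝ))
  have h4 : mfderiv (IJ n) 𝓘(ℝ, ℝ) (coordDt (n := n)) z = coordDt :=
    coordDt.hasMFDerivAt.mfderiv
  rw [h4] at h3
  exact DFunLike.congr_fun (h1.symm.trans h3) u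

/-- In a natural chart `w ↦ vshift v w` is the affine map `w ↦ z + B w`, so its derivative at `0` is
the linear part `B`. -/
theorem vlift_fromMod (u : EMod n) :
    vlift ((J1.natChart hφ).symm z) (fromMod φ z.1 u) =
      J1.ofCoord hφ z (0, u.2 - u.1 • z.2) := by
  set v := (J1.natChart hφ).symm z with hv
  have hvpt : v.pt ∈ φ.source := φ.map_target hz.1
  have hvel : toMod φ v.pt v.vel = (1, z.2) := by
    rw [J1.natChart_symm_vel hφ hz]
    exact hφ.toMod_fromMod hz.1 _
  have hshift : ∀ w : TangentSpace 𝓘(ℝ, EMod n) v.pt, (toMod φ v.pt (vshift v w).vel).2 =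
      z.2 + ((toMod φ v.pt w).2 - (toMod φ v.pt w).1 • z.2) := by
    intro w
    change (toMod φ v.pt (v.vel + (w - mvfderiv 𝓘(ℝ, EMod n) π v.pt w • v.vel))).2 = _
    rw [map_add, map_sub, map_smul, hvel, hφ.dt_eq hvpt w]
    rfl
  let A : EMod n →L[ℝ] EMod n := toMod φ v.pt
  let B : EMod n →L[ℝ] EMod n × Fib n := (coordEndo z).comp
    ((ContinuousLinearMap.inl ℝ (EMod n) (Fib n)).comp A)
  have h1 : (fun w : EMod n => vshift v w) = fun w => (J1.natChart hφ).symm (z + B w) := by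
    funext w
    have hs : vshift v w ∈ (J1.natChart hφ).source := hvpt
    rw [← (J1.natChart hφ).left_inv hs]
    congr 1
    refine Prod.ext ?_ ?_
    · change φ (φ.symm z.1) = z.1 + 0
      rw [φ.right_inv hz.1, add_zero]
    · exact hshift w
  have hz0 : z + B 0 = z := by simp
  have h2 : MDifferentiableAt 𝓘(ℝ, EMod n) (IJ n) (fun w => z + B w) 0 :=
    (B.differentiableAt.const_add z).mdifferentiableAt
  have h3 : mfderiv 𝓘(ℝ, EMod n) (IJ n) (fun w => z + B w) 0 = B := by
    rw [mfderiv_eq_fderiv]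
    exact (B.hasFDerivAt.const_add z).fderiv
  have h4 := mfderiv_comp_of_eq (I := 𝓘(ℝ, EMod n)) (I' := IJ n) (I'' := IJ n) (x := 0)
    ((J1.contMDiffAt_natChart_symm hφ hz).mdifferentiableAt (by simp)) h2 hz0
  rw [h3] at h4
  have h5 : B (fromMod φ z.1 u) = (0, u.2 - u.1 • z.2) := by
    change coordEndo z (toMod φ (φ.symm z.1) (fromMod φ z.1 u), 0) = _
    rw [hφ.toMod_fromMod hz.1]
    rfl
  rw [← h5]
  unfold vlift
  rw [h1]
  -- The chain rule yields the derivative at `z + B 0`. It is moved to `z` by viewing both tangent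
  -- spaces as the model space.
  have h6 : ∀ y, y = z → ∀ u : EMod n × Fib n,
      (mfderiv (IJ n) (IJ n) (J1.natChart hφ).symm y u : EMod n × Fib n) =
        mfderiv (IJ n) (IJ n) (J1.natChart hφ).symm z u := by
    rintro _ rfl u
    rfl
  exact (DFunLike.congr_fun h4 _).trans (h6 _ hz0 _)

omit hz in
/-- The Lagrangian in natural coordinates. -/
def coordLagrangian (L : J1 n π → ℝ) (z : EMod n × Fib n) : ℝ := L ((J1.natChart hφ).symm z)

variable {L : J1 n π → ℝ} (hL : ContMDiff (IJ n) 𝓘(ℝ, ℝ) ∞ L)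
include hL

theorem contDiffAt_coordLagrangian : ContDiffAt ℝ ∞ (coordLagrangian hφ L) z := by
  rw [← contMDiffAt_iff_contDiffAt]
  exact hL.contMDiffAt.comp z (J1.contMDiffAt_natChart_symm hφ hz)

theorem mvfderiv_lagrangian_ofCoord (u : EMod n × Fib n) :
    mvfderiv (IJ n) L ((J1.natChart hφ).symm z) (J1.ofCoord hφ z u) =
      fderiv ℝ (coordLagrangian hφ L) z u := by
  have h1 := mfderiv_comp (I := IJ n) (I' := IJ n) (I'' := 𝓘(ℝ, ℝ)) z
    (hL.contMDiffAt.mdifferentiableAt (by simp))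
    ((J1.contMDiffAt_natChart_symm hφ hz).mdifferentiableAt (by simp))
  rw [mfderiv_eq_fderiv] at h1
  exact (DFunLike.congr_fun h1 u).symm

theorem legendreCov_fromMod (u : EMod n) :
    legendreCov L ((J1.natChart hφ).symm z) (fromMod φ z.1 u) =
      coordTheta (coordLagrangian hφ L) z (u, 0) := by
  rw [coordTheta_apply]
  change L _ * mvfderiv 𝓘(ℝ, EMod n) π (φ.symm z.1) (fromMod φ z.1 u) +
    mvfderiv (IJ n) L _ (vlift _ (fromMod φ z.1 u)) = _
  rw [vlift_fromMod hφ hz, mvfderiv_lagrangian_ofCoord hφ hz hL,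
    hφ.dt_eq (φ.map_target hz.1), hφ.toMod_fromMod hz.1]
  rfl

/-- `Θ_L` is semibasic, so its value is that of the Legendre covector on the projected vector;
likewise `coordTheta` ignores the velocity component. -/
theorem poincareCartan_ofCoord (u : EMod n × Fib n) :
    poincareCartan L ((J1.natChart hφ).symm z) (J1.ofCoord hφ z u) =
      coordTheta (coordLagrangian hφ L) z u := by
  rw [← legendreCov_apply, J1.mfderiv_pt_ofCoord hφ hz, legendreCov_fromMod hφ hz hL]
  rfl

omit hz in
-- `dForm` is computed in the preferred chart at `v`. That chart is itself a natural chart, so the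
-- local representative is `coordTheta` near the point. This supplies the differentiability
-- hypothesis of `dForm_mfderiv`.
theorem differentiableAt_localRep_poincareCartan (v : J1 n π) :
    DifferentiableAt ℝ (localRep (IJ n) (poincareCartan L) v) (extChartAt (IJ n) v v) := by
  obtain ⟨ψ, hψ, hv, hc⟩ := J1.exists_chartAt_eq v
  have hv' : J1.natChart hψ v ∈ (J1.natChart hψ).target := (J1.natChart hψ).map_source hv
  have h1 : extChartAt (IJ n) v v = J1.natChart hψ v := by
    rw [← hc]; rfl
  have h2 : ⇑(extChartAt (IJ n) v).symm = (J1.natChart hψ).symm := by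
    rw [← hc]; rfl
  rw [h1]
  refine DifferentiableAt.congr_of_eventuallyEq
    ((contDiffAt_coordTheta (contDiffAt_coordLagrangian hψ hv' hL)).differentiableAt (by simp)) ?_
  filter_upwards [(J1.natChart hψ).open_target.mem_nhds hv'] with y hy
  refine ContinuousLinearMap.ext fun u => ?_
  rw [← poincareCartan_ofCoord hψ hy hL]
  unfold localRep
  rw [h2]
  rfl

theorem omegaL_ofCoord (u w : EMod n × Fib n) :
    omegaL L ((J1.natChart hφ).symm z) (J1.ofCoord hφ z u) (J1.ofCoord hφ z w) =
      -(fderiv ℝ (coordTheta (coordLagrangian hφ L)) z u w -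
        fderiv ℝ (coordTheta (coordLagrangian hφ L)) z w u) := by
  have h := dForm_mfderiv (I := IJ n) (θ := poincareCartan L) (f := (J1.natChart hφ).symm)
    (J1.contMDiffAt_natChart_symm hφ hz) (differentiableAt_localRep_poincareCartan hL _)
    (T := coordTheta (coordLagrangian hφ L)) (by
      filter_upwards [(J1.natChart hφ).open_target.mem_nhds hz] with y hy u
      exact (poincareCartan_ofCoord hφ hy hL u).symm) u w
  exact congrArg Neg.neg h

/-- `hessian` is the matrix of `velHessian` in the standard basis. The coordinates of a `d` in the
kernel form a row vector annihilated by this non-singular matrix. -/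
theorem velHessian_injective (hreg : IsRegular L) (d : Fib n)
    (hd : velHessian (coordLagrangian hφ L) z d = 0) : d = 0 := by
  set l := coordLagrangian hφ L with hl
  set v := (J1.natChart hφ).symm z with hv
  have hvz : J1.natChart hφ v = z := (J1.natChart hφ).right_inv hz
  have hpt : φ v.pt = z.1 := φ.right_inv hz.1
  have hin : ∀ w : Fib n, HasFDerivAt (fun w' : Fib n => (z.1, w'))
      (ContinuousLinearMap.inr ℝ (EMod n) (Fib n)) w := fun w => hasFDerivAt_prodMk_right _ _
  have htgt : ∀ w : Fib n, (z.1, w) ∈ (J1.natChart hφ).target := fun w => ⟨hz.1, mem_univ _⟩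
  have h1 : ∀ w c : Fib n, fderiv ℝ (fun w' => l (z.1, w')) w c = fderiv ℝ l (z.1, w) (0, c) := by
    intro w c
    have := ((contDiffAt_coordLagrangian hφ (htgt w) hL).differentiableAt
      (by simp)).hasFDerivAt.comp w (hin w)
    exact DFunLike.congr_fun this.fderiv c
  have h2 : ∀ A B, hessian L φ hφ v A B =
      velHessian l z (EuclideanSpace.single A 1) (EuclideanSpace.single B 1) := by
    intro A B
    change fderiv ℝ (fun w => fderiv ℝ (fun w' => l (φ v.pt, w')) w
      (EuclideanSpace.single B 1)) (J1.natChart hφ v).2 (EuclideanSpace.single A 1) = _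
    rw [hvz, hpt]
    simp only [h1]
    have h3 := (((contDiffAt_coordLagrangian hφ hz hL).fderiv_right (m := ∞)
      (by simp)).differentiableAt (by simp)).hasFDerivAt.comp (x := z.2)
      (f := fun w' : Fib n => (z.1, w')) (hin z.2)
    have h4 := h3.clm_apply (hasFDerivAt_const
      ((0, EuclideanSpace.single B 1) : EMod n × Fib n) z.2)
    have h5 := DFunLike.congr_fun h4.fderiv (EuclideanSpace.single A 1)
    simp only [Function.comp_def] at h5
    rw [h5]
    simp [l]
  have hdet := hreg φ hφ v (φ.map_target hz.1)
  have h3 : Matrix.vecMul (fun A => d A) (hessian L φ hφ v) = 0 := by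
    funext B
    have h4 : d = ∑ A, d A • EuclideanSpace.single A (1 : ℝ) := by
      ext i
      simp [Pi.single_apply]
    have h5 : velHessian l z d (EuclideanSpace.single B 1) = 0 := by rw [hd]; rfl
    rw [h4, map_sum] at h5
    simp only [Matrix.vecMul, dotProduct, h2, Pi.zero_apply]
    rw [← h5, sum_apply]
    simp
  have h4 := Matrix.eq_zero_of_vecMul_eq_zero hdet h3
  ext i
  exact congrFun h4 i

/-- Test vectors may be taken to be coordinate vectors, as `J1.ofCoord` is bijective. The single
formula valid on a whole chart gives existence and uniqueness, and later smoothness. -/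
theorem eulerLagrange_iff (hreg : IsRegular L)
    (X : TangentSpace (IJ n) ((J1.natChart hφ).symm z)) :
    (omegaL L _ X = 0 ∧ etaJ _ X = 1) ↔
      X = J1.ofCoord hφ z (coordField (coordLagrangian hφ L) z) := by
  obtain ⟨X, rfl⟩ := (J1.ofCoord_bijective hφ hz).2 X
  rw [(J1.ofCoord_bijective hφ hz).1.eq_iff, etaJ_ofCoord hφ hz,
    ← eq_coordField_iff (contDiffAt_coordLagrangian hφ hz hL)
      (velHessian_injective hφ hz hL hreg)]
  refine and_congr_left fun _ => ?_
  rw [LinearMap.ext_iff, (J1.ofCoord_bijective hφ hz).2.forall]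
  refine forall_congr' fun W => ?_
  rw [omegaL_ofCoord hφ hz hL, LinearMap.zero_apply, neg_eq_zero]

end JetCoordinates

/-! ### The Liouville form and smooth covector fields in the charts of `T*E`. -/

section Cotangent
variable {n : ℕ} {E : Type u} [TopologicalSpace E] [ChartedSpace (EMod n) E]
  [IsManifold 𝓘(ℝ, EMod n) ∞ E]

theorem inCoordinates_cot_apply (x₀ x : E) (α : TangentSpace 𝓘(ℝ, EMod n) x →L[ℝ] ℝ) (u : EMod n) :
    ContinuousLinearMap.inCoordinates (EMod n) (TangentSpace 𝓘(ℝ, EMod n)) ℝ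
      (Bundle.Trivial E ℝ) x₀ x x₀ x α u =
      α ((trivializationAt (EMod n) (TangentSpace 𝓘(ℝ, EMod n)) x₀).symmL ℝ x u) := by
  unfold ContinuousLinearMap.inCoordinates
  have h : (trivializationAt ℝ (Bundle.Trivial E ℝ) x₀).continuousLinearMapAt ℝ x =
      ContinuousLinearMap.id ℝ ℝ := Bundle.Trivial.continuousLinearMapAt_trivialization ℝ E ℝ x
  rw [h]
  rfl

/-- In the preferred charts of `T*E` the Liouville form is `(x, a) ↦ a ∘ dx`. -/
theorem localRep_liouville (α : CotBundle n E) {y : EMod n × (EMod n →L[ℝ] ℝ)}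
    (hy : y ∈ (extChartAt (ICot n) α).target) :
    localRep (ICot n) liouville α y =
      y.2.comp (ContinuousLinearMap.fst ℝ (EMod n) (EMod n →L[ℝ] ℝ)) := by
  have hmf : IsManifold 𝓘(ℝ, EMod n) 1 E := IsManifold.of_le (n := ∞) (by simp)
  set e := extChartAt (ICot n) α with he
  set c := extChartAt 𝓘(ℝ, EMod n) α.proj with hc
  have happ : ∀ β : CotBundle n E, e β = (c β.proj,
      ContinuousLinearMap.inCoordinates (EMod n) (TangentSpace 𝓘(ℝ, EMod n)) ℝ
      (Bundle.Trivial E ℝ) α.proj β.proj α.proj β.proj β.2) := by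
    intro β
    rw [he, FiberBundle.extChartAt]
    change (c (trivializationAt (EMod n →L[ℝ] ℝ)
      (fun x : E => TangentSpace 𝓘(ℝ, EMod n) x →L[ℝ] Bundle.Trivial E ℝ x) α.proj β).1,
      (trivializationAt (EMod n →L[ℝ] ℝ)
      (fun x : E => TangentSpace 𝓘(ℝ, EMod n) x →L[ℝ] Bundle.Trivial E ℝ x) α.proj β).2) = _
    rw [hom_trivializationAt_apply]
  have hopen := isOpen_extChartAt_target (I := ICot n) α
  have hesrc : ∀ β ∈ e.source, β.proj ∈ c.source := by
    intro β hβ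
    rw [he, FiberBundle.extChartAt] at hβ
    have h : (trivializationAt (EMod n →L[ℝ] ℝ)
      (fun x : E => TangentSpace 𝓘(ℝ, EMod n) x →L[ℝ] Bundle.Trivial E ℝ x) α.proj β).1 ∈
        c.source := hβ.2.1
    rwa [hom_trivializationAt_apply] at h
  have hsrc : ∀ y ∈ e.target, (e.symm y).proj ∈ c.source ∧ c (e.symm y).proj = y.1 := by
    intro y hy
    have h2 := congrArg Prod.fst ((happ (e.symm y)).symm.trans (e.right_inv hy))
    exact ⟨hesrc _ (e.map_target hy), h2⟩
  have hproj : (Bundle.TotalSpace.proj ∘ e.symm : _ → E) =ᶠ[𝓝 y] c.symm ∘ Prod.fst := by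
    filter_upwards [hopen.mem_nhds hy] with y' hy'
    obtain ⟨h1, h2⟩ := hsrc y' hy'
    change _ = c.symm y'.1
    rw [← h2, c.left_inv h1]
    rfl
  have h1 := mfderiv_comp (I := 𝓘(ℝ, EMod n × (EMod n →L[ℝ] ℝ))) (I' := ICot n)
    (I'' := 𝓘(ℝ, EMod n)) (g := (Bundle.TotalSpace.proj : CotBundle n E → E)) (f := e.symm) y
    ((Bundle.contMDiff_proj (n := 1) _).mdifferentiableAt (by simp))
    (((contMDiffOn_extChartAt_symm (n := ∞) α).contMDiffAt (hopen.mem_nhds hy)).mdifferentiableAt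
      (by simp))
  have hy1 : y.1 ∈ c.target := by
    rw [← (hsrc y hy).2]
    exact c.map_source (hsrc y hy).1
  have h2 := mfderiv_comp (I := 𝓘(ℝ, EMod n × (EMod n →L[ℝ] ℝ))) (I' := 𝓘(ℝ, EMod n))
    (I'' := 𝓘(ℝ, EMod n)) (g := c.symm) (f := Prod.fst) y
    (((contMDiffOn_extChartAt_symm (n := ∞) α.proj).contMDiffAt
      ((isOpen_extChartAt_target (I := 𝓘(ℝ, EMod n)) α.proj).mem_nhds hy1)).mdifferentiableAt
      (by simp))
    (ContinuousLinearMap.fst ℝ (EMod n) (EMod n →L[ℝ] ℝ)).mdifferentiableAt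
  have h4 : mfderiv 𝓘(ℝ, EMod n × (EMod n →L[ℝ] ℝ)) 𝓘(ℝ, EMod n)
      (Prod.fst : EMod n × (EMod n →L[ℝ] ℝ) → EMod n) y
      = ContinuousLinearMap.fst ℝ (EMod n) (EMod n →L[ℝ] ℝ) :=
    (ContinuousLinearMap.fst ℝ (EMod n) (EMod n →L[ℝ] ℝ)).hasMFDerivAt.mfderiv
  rw [h4] at h2
  have h5 := h1.symm.trans (hproj.mfderiv_eq.trans h2)
  have h6 := TangentBundle.symmL_trivializationAt (I := 𝓘(ℝ, EMod n)) (x₀ := α.proj)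
    (x := (e.symm y).proj) (by simpa [hc] using (hsrc y hy).1)
  -- The fibre coordinate of a covector is its composite with the tangent trivialisation, which by
  -- `h6` is the differential of `c.symm`. By `h5` the bundle projection, read through `e.symm`, has
  -- this same differential composed with the first projection.
  have h7 : ∀ u : EMod n, y.2 u = (e.symm y).2
      ((trivializationAt (EMod n) (TangentSpace 𝓘(ℝ, EMod n)) α.proj).symmL ℝ (e.symm y).proj u) := by
    intro u
    rw [← inCoordinates_cot_apply α.proj]
    exact DFunLike.congr_fun (congrArg Prod.snd
      ((e.right_inv hy).symm.trans (happ (e.symm y)))) u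
  refine ContinuousLinearMap.ext fun u => ?_
  change (e.symm y).2 (mfderiv (ICot n) 𝓘(ℝ, EMod n) Bundle.TotalSpace.proj (e.symm y)
    (mfderiv 𝓘(ℝ, EMod n × (EMod n →L[ℝ] ℝ)) (ICot n) e.symm y u)) = y.2 u.1
  rw [h7, h6]
  have h8 := (hsrc y hy).2
  rw [← hc, h8, modelWithCornersSelf_coe, range_id, mfderivWithin_univ]
  exact congrArg (e.symm y).2 (DFunLike.congr_fun h5 u)

theorem differentiableAt_localRep_liouville (α : CotBundle n E) :
    DifferentiableAt ℝ (localRep (ICot n) liouville α) (extChartAt (ICot n) α α) := by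
  have h : DifferentiableAt ℝ (fun y : EMod n × (EMod n →L[ℝ] ℝ) =>
      y.2.comp (ContinuousLinearMap.fst ℝ (EMod n) (EMod n →L[ℝ] ℝ))) (extChartAt (ICot n) α α) :=
    differentiableAt_snd.clm_comp (differentiableAt_const _)
  refine h.congr_of_eventuallyEq ?_
  filter_upwards [(isOpen_extChartAt_target (I := ICot n) α).mem_nhds
    (mem_extChartAt_target (I := ICot n) α)] with y hy
  exact localRep_liouville α hy

/-- The covector `a ∘ dφ` depends smoothly on the base point and on `a`. -/
theorem contMDiffAt_covector {π : E → ℝ} {φ : OpenPartialHomeomorph E (EMod n)}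
    (hφ : IsBundleChart π φ) {y : EMod n × (EMod n →L[ℝ] ℝ)} (hy : y.1 ∈ φ.target) :
    ContMDiffAt 𝓘(ℝ, EMod n × (EMod n →L[ℝ] ℝ)) (ICot n) ∞
      (fun z : EMod n × (EMod n →L[ℝ] ℝ) =>
        (⟨φ.symm z.1, z.2.comp (toMod φ (φ.symm z.1))⟩ : CotBundle n E)) y := by
  have hmf : IsManifold 𝓘(ℝ, EMod n) 1 E := IsManifold.of_le (n := ∞) (by simp)
  have hbase : ContMDiffAt 𝓘(ℝ, EMod n × (EMod n →L[ℝ] ℝ)) 𝓘(ℝ, EMod n) ∞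
      (fun z : EMod n × (EMod n →L[ℝ] ℝ) => φ.symm z.1) y :=
    ((hφ.smooth_symm.contMDiffAt (φ.open_target.mem_nhds hy))).comp y
      (contDiff_fst (𝕜 := ℝ) (E := EMod n) (F := EMod n →L[ℝ] ℝ)).contMDiff.contMDiffAt
  rw [contMDiffAt_hom_bundle]
  refine ⟨hbase, ?_⟩
  -- The differential of `φ` in tangent coordinates depends smoothly on the base point; composing
  -- `z.2` with it gives the coordinate expression of the covector.
  have h1 := ((hφ.smooth.contMDiffAt
    (φ.open_source.mem_nhds (φ.map_target hy))).mfderiv_const (m := ∞) (by simp)).comp y hbase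
  have h2 : ContMDiffAt 𝓘(ℝ, EMod n × (EMod n →L[ℝ] ℝ)) 𝓘(ℝ, EMod n →L[ℝ] ℝ) ∞
      (fun z : EMod n × (EMod n →L[ℝ] ℝ) => z.2) y :=
    (contDiff_snd (𝕜 := ℝ) (E := EMod n) (F := EMod n →L[ℝ] ℝ)).contMDiff.contMDiffAt
  refine (h2.clm_comp h1).congr_of_eventuallyEq (Filter.Eventually.of_forall fun z => ?_)
  refine ContinuousLinearMap.ext fun u => ?_
  rw [inCoordinates_cot_apply]
  change z.2 (toMod φ (φ.symm z.1) _) = z.2 (ContinuousLinearMap.inCoordinates (EMod n)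
    (TangentSpace 𝓘(ℝ, EMod n)) (EMod n) (TangentSpace 𝓘(ℝ, EMod n)) _ _ _ _ _ u)
  unfold ContinuousLinearMap.inCoordinates
  rw [TangentBundle.continuousLinearMapAt_model_space]
  rfl

end Cotangent

/-! ### Natural coordinates on `T*E ×_E J¹π` and the form `ω_H`. -/

section MixedCoordinates
set_option linter.unusedSectionVars false
variable {n : ℕ} {E : Type u} [TopologicalSpace E] [ChartedSpace (EMod n) E]
  [IsManifold 𝓘(ℝ, EMod n) ∞ E] {π : E → ℝ} [IsFibreBundle n π]
  {φ : OpenPartialHomeomorph E (EMod n)} (hφ : IsBundleChart π φ)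

/-- A natural chart of `T*E ×_E J¹π` as an open partial homeomorphism. -/
def Mixed.natChart : OpenPartialHomeomorph (Mixed n π) (PMod n) :=
  (Mixed.core n π).openPartialHomeomorph (Mixed.chart φ hφ) ⟨φ, hφ, rfl⟩

theorem Mixed.natChart_mem_atlas : Mixed.natChart hφ ∈ atlas (PMod n) (Mixed n π) := by
  change _ ∈ ⋃ (f : PartialEquiv (Mixed n π) (PMod n)) (hf : f ∈ (Mixed.core n π).atlas),
    {(Mixed.core n π).openPartialHomeomorph f hf}
  simp only [mem_iUnion, mem_singleton_iff]
  exact ⟨Mixed.chart φ hφ, ⟨φ, hφ, rfl⟩, rfl⟩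

theorem Mixed.contMDiffOn_natChart :
    ContMDiffOn (IP n) (IP n) ∞ (Mixed.natChart hφ) (Mixed.natChart hφ).source :=
  contMDiffOn_of_mem_maximalAtlas
    (IsManifold.subset_maximalAtlas (Mixed.natChart_mem_atlas hφ))

theorem Mixed.contMDiffOn_natChart_symm :
    ContMDiffOn (IP n) (IP n) ∞ (Mixed.natChart hφ).symm (Mixed.natChart hφ).target :=
  contMDiffOn_symm_of_mem_maximalAtlas
    (IsManifold.subset_maximalAtlas (Mixed.natChart_mem_atlas hφ))

theorem Mixed.mdifferentiable_natChart : (Mixed.natChart hφ).MDifferentiable (IP n) (IP n) :=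
  ⟨(Mixed.contMDiffOn_natChart hφ).mdifferentiableOn (by simp),
    (Mixed.contMDiffOn_natChart_symm hφ).mdifferentiableOn (by simp)⟩

/-- The coordinate vector `u` at `z`, as a tangent vector of `T*E ×_E J¹π`. -/
def Mixed.ofCoord (z : PMod n) :
    PMod n →L[ℝ] TangentSpace (IP n) ((Mixed.natChart hφ).symm z) :=
  mfderiv (IP n) (IP n) (Mixed.natChart hφ).symm z

theorem Mixed.exists_natChart_symm_eq (p : Mixed n π) :
    ∃ (φ : OpenPartialHomeomorph E (EMod n)) (hφ : IsBundleChart π φ),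
      ∃ z ∈ (Mixed.natChart hφ).target, (Mixed.natChart hφ).symm z = p := by
  obtain ⟨φ, hφ, hp⟩ := exists_bundleChart (n := n) π p.jet.pt
  have hp' : p ∈ (Mixed.natChart hφ).source := hp
  exact ⟨φ, hφ, _, (Mixed.natChart hφ).map_source hp', (Mixed.natChart hφ).left_inv hp'⟩

theorem J1.exists_natChart_symm_eq (v : J1 n π) :
    ∃ (φ : OpenPartialHomeomorph E (EMod n)) (hφ : IsBundleChart π φ),
      ∃ z ∈ (J1.natChart hφ).target, (J1.natChart hφ).symm z = v := by
  obtain ⟨φ, hφ, hp⟩ := exists_bundleChart (n := n) π v.pt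
  have hp' : v ∈ (J1.natChart hφ).source := hp
  exact ⟨φ, hφ, _, (J1.natChart hφ).map_source hp', (J1.natChart hφ).left_inv hp'⟩

/-- Projection of the coordinates of `T*E ×_E J¹π` onto those of `J¹π`. -/
def coordPr2 : PMod n →L[ℝ] EMod n × Fib n :=
  (ContinuousLinearMap.fst ℝ _ _).prod
    ((ContinuousLinearMap.snd ℝ _ _).comp (ContinuousLinearMap.snd ℝ _ _))

/-- Projection of the coordinates of `T*E ×_E J¹π` onto those of `T*E`. -/
def coordPr1 : PMod n →L[ℝ] EMod n × (EMod n →L[ℝ] ℝ) :=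
  (ContinuousLinearMap.fst ℝ _ _).prod
    ((ContinuousLinearMap.fst ℝ _ _).comp (ContinuousLinearMap.snd ℝ _ _))

@[simp] theorem coordPr2_apply (u : PMod n) : coordPr2 u = (u.1, u.2.2) := rfl
variable {z : PMod n} (hz : z ∈ (Mixed.natChart hφ).target)
include hz

theorem coordPr2_mem_target : coordPr2 z ∈ (J1.natChart hφ).target := ⟨hz.1, mem_univ _⟩

theorem Mixed.contMDiffAt_natChart_symm :
    ContMDiffAt (IP n) (IP n) ∞ (Mixed.natChart hφ).symm z :=
  (Mixed.contMDiffOn_natChart_symm hφ).contMDiffAt ((Mixed.natChart hφ).open_target.mem_nhds hz)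

theorem Mixed.ofCoord_surjective : Function.Surjective (Mixed.ofCoord hφ z) :=
  ((Mixed.mdifferentiable_natChart hφ).symm.mfderiv_bijective hz).2

/-- Smoothness on `T*E ×_E J¹π` may be checked in a natural chart. -/
theorem Mixed.contMDiffAt_of_comp_natChart_symm {V : Type*} [NormedAddCommGroup V]
    [NormedSpace ℝ V] {H : Type*} [TopologicalSpace H] {I : ModelWithCorners ℝ V H} {M : Type*}
    [TopologicalSpace M] [ChartedSpace H M] {h : Mixed n π → M}
    (hh : ContMDiffAt (IP n) I ∞ (h ∘ (Mixed.natChart hφ).symm) z) :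
    ContMDiffAt (IP n) I ∞ h ((Mixed.natChart hφ).symm z) := by
  have hs := (Mixed.natChart hφ).map_target hz
  have h1 := (Mixed.contMDiffOn_natChart hφ).contMDiffAt
    ((Mixed.natChart hφ).open_source.mem_nhds hs)
  have h2 : ContMDiffAt (IP n) I ∞ (h ∘ (Mixed.natChart hφ).symm)
      (Mixed.natChart hφ ((Mixed.natChart hφ).symm z)) := by
    rwa [(Mixed.natChart hφ).right_inv hz]
  refine (h2.comp _ h1).congr_of_eventuallyEq ?_
  filter_upwards [(Mixed.natChart hφ).open_source.mem_nhds hs] with p hp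
  simp only [Function.comp_apply, (Mixed.natChart hφ).left_inv hp]

theorem contMDiffAt_pr1_comp :
    ContMDiffAt (IP n) (ICot n) ∞ ((pr1 : Mixed n π → CotBundle n E) ∘ (Mixed.natChart hφ).symm) z :=
  (contMDiffAt_covector hφ (y := coordPr1 z) hz.1).comp z coordPr1.contMDiff.contMDiffAt

theorem contMDiffAt_pr2_comp :
    ContMDiffAt (IP n) (IJ n) ∞ ((pr2 : Mixed n π → J1 n π) ∘ (Mixed.natChart hφ).symm) z :=
  (J1.contMDiffAt_natChart_symm hφ (coordPr2_mem_target hφ hz)).comp z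
    coordPr2.contMDiff.contMDiffAt

omit hz in
theorem contMDiff_pr1 : ContMDiff (IP n) (ICot n) ∞ (pr1 : Mixed n π → CotBundle n E) := by
  intro p
  obtain ⟨φ, hφ, z, hz, rfl⟩ := Mixed.exists_natChart_symm_eq p
  exact Mixed.contMDiffAt_of_comp_natChart_symm hφ hz (contMDiffAt_pr1_comp hφ hz)

omit hz in
theorem contMDiff_pr2 : ContMDiff (IP n) (IJ n) ∞ (pr2 : Mixed n π → J1 n π) := by
  intro p
  obtain ⟨φ, hφ, z, hz, rfl⟩ := Mixed.exists_natChart_symm_eq p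
  exact Mixed.contMDiffAt_of_comp_natChart_symm hφ hz (contMDiffAt_pr2_comp hφ hz)

omit hz in
theorem contMDiff_bundle_proj : ContMDiff 𝓘(ℝ, EMod n) 𝓘(ℝ, ℝ) ∞ π := by
  intro x
  obtain ⟨φ, hφ, hx⟩ := exists_bundleChart (n := n) π x
  have h1 : π =ᶠ[𝓝 x] (fun z => (φ z).1) :=
    Filter.eventuallyEq_of_mem (φ.open_source.mem_nhds hx) fun y hy => (hφ.fst_eq y hy).symm
  refine ContMDiffAt.congr_of_eventuallyEq ?_ h1
  exact (ContinuousLinearMap.fst ℝ ℝ (Fib n)).contMDiff.contMDiffAt.comp x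
    (hφ.smooth.contMDiffAt (φ.open_source.mem_nhds hx))

theorem mfderiv_pr2_ofCoord (u : PMod n) :
    mfderiv (IP n) (IJ n) pr2 ((Mixed.natChart hφ).symm z) (Mixed.ofCoord hφ z u) =
      J1.ofCoord hφ (coordPr2 z) (coordPr2 u) := by
  have h1 := mfderiv_comp (I := IP n) (I' := IP n) (I'' := IJ n) z
    (g := (pr2 : Mixed n π → J1 n π)) (f := (Mixed.natChart hφ).symm)
    (contMDiff_pr2.mdifferentiableAt (by simp))
    ((Mixed.contMDiffAt_natChart_symm hφ hz).mdifferentiableAt (by simp))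
  have h2 := mfderiv_comp (I := IP n) (I' := IJ n) (I'' := IJ n) z
    (g := (J1.natChart hφ).symm) (f := coordPr2)
    ((J1.contMDiffAt_natChart_symm hφ (coordPr2_mem_target hφ hz)).mdifferentiableAt (by simp))
    coordPr2.mdifferentiableAt
  have h4 : mfderiv (IP n) (IJ n) (coordPr2 (n := n)) z = coordPr2 :=
    coordPr2.hasMFDerivAt.mfderiv
  rw [h4] at h2
  exact DFunLike.congr_fun (h1.symm.trans h2) u

omit hz in
/-- The form `η` is the pull-back of `π_1^* dt` along `pr_2`. -/
theorem eta_eq_etaJ (p : Mixed n π) (Z : TangentSpace (IP n) p) :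
    eta p Z = etaJ (pr2 p) (mfderiv (IP n) (IJ n) pr2 p Z) := by
  have hpi : MDifferentiableAt (IJ n) 𝓘(ℝ, ℝ) (pi1 (n := n) (π := π)) (pr2 p) :=
    (contMDiff_bundle_proj.comp contMDiff_pt).mdifferentiableAt (by simp)
  have h1 := mfderiv_comp (I := IP n) (I' := IJ n) (I'' := 𝓘(ℝ, ℝ)) p hpi
    (contMDiff_pr2.mdifferentiableAt (by simp))
  exact DFunLike.congr_fun h1 Z

omit hz in
-- Tautological property of the Liouville form: its pull-back along `f` is the covector `f y`
-- composed with the differential of the base map. It serves both the natural charts and the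
-- Legendre map.
theorem canonicalForm_mfderiv {V : Type*} [NormedAddCommGroup V] [NormedSpace ℝ V]
    {f : V → CotBundle n E} {y : V} (hf : ContMDiffAt 𝓘(ℝ, V) (ICot n) ∞ f y)
    {T : V → V →L[ℝ] ℝ}
    (hT : ∀ᶠ y' in 𝓝 y, ∀ u : V, T y' u =
      (f y').2 (mfderiv 𝓘(ℝ, V) 𝓘(ℝ, EMod n) (fun x => (f x).proj) y' u)) (u w : V) :
    canonicalForm (f y) (mfderiv 𝓘(ℝ, V) (ICot n) f y u) (mfderiv 𝓘(ℝ, V) (ICot n) f y w) =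
      -(fderiv ℝ T y u w - fderiv ℝ T y w u) := by
  have h := dForm_mfderiv (I := ICot n) (θ := liouville) hf
    (differentiableAt_localRep_liouville _) (T := T) (by
      have hn : ∀ᶠ y' in 𝓝 y, ContMDiffAt 𝓘(ℝ, V) (ICot n) 1 f y' :=
        (contMDiffAt_iff_contMDiffAt_nhds (by simp)).1 (hf.of_le (by simp : (1 : ℕ∞ω) ≤ ∞))
      have hn' : ∀ᶠ y' in 𝓝 y, MDifferentiableAt 𝓘(ℝ, V) (ICot n) f y' :=
        hn.mono fun y' h => h.mdifferentiableAt (by simp)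
      filter_upwards [hT, hn'] with y' h1 h2 u
      rw [h1]
      have h3 := mfderiv_comp (I := 𝓘(ℝ, V)) (I' := ICot n) (I'' := 𝓘(ℝ, EMod n)) y'
        (g := (Bundle.TotalSpace.proj : CotBundle n E → E)) (f := f)
        ((Bundle.contMDiff_proj (n := 1) _).mdifferentiableAt (by simp)) h2
      exact congrArg (f y').2 (DFunLike.congr_fun h3 u)) u w
  exact congrArg Neg.neg h

/-- The pulled-back Liouville form is `z ↦ z.2.1 ∘ fst`, linear in `z`, so its derivative in
direction `u` evaluated on `w` is `u.2.1 w.1`. -/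
theorem canonicalForm_ofCoord (u w : PMod n) :
    pullbackForm (IP n) (ICot n) pr1 canonicalForm ((Mixed.natChart hφ).symm z)
      (Mixed.ofCoord hφ z u) (Mixed.ofCoord hφ z w) = w.2.1 u.1 - u.2.1 w.1 := by
  have h1 := mfderiv_comp (I := IP n) (I' := IP n) (I'' := ICot n) z
    (g := (pr1 : Mixed n π → CotBundle n E)) (f := (Mixed.natChart hφ).symm)
    (contMDiff_pr1.mdifferentiableAt (by simp))
    ((Mixed.contMDiffAt_natChart_symm hφ hz).mdifferentiableAt (by simp))
  let T : PMod n → PMod n →L[ℝ] ℝ := fun z => z.2.1.comp (ContinuousLinearMap.fst ℝ _ _)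
  have h2 := canonicalForm_mfderiv (contMDiffAt_pr1_comp hφ hz) (T := T) (by
    filter_upwards [(Mixed.natChart hφ).open_target.mem_nhds hz] with y hy u
    have h3 := mfderiv_comp (I := IP n) (I' := 𝓘(ℝ, EMod n)) (I'' := 𝓘(ℝ, EMod n)) y
      (g := φ.symm) (f := Prod.fst) (hφ.mdiff.symm.mdifferentiableAt hy.1)
      (ContinuousLinearMap.fst ℝ (EMod n) ((EMod n →L[ℝ] ℝ) × Fib n)).mdifferentiableAt
    have h4 : mfderiv (IP n) 𝓘(ℝ, EMod n) (Prod.fst : PMod n → EMod n) y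
        = ContinuousLinearMap.fst ℝ (EMod n) ((EMod n →L[ℝ] ℝ) × Fib n) :=
      (ContinuousLinearMap.fst ℝ (EMod n) ((EMod n →L[ℝ] ℝ) × Fib n)).hasMFDerivAt.mfderiv
    rw [h4] at h3
    have h5 : mfderiv (IP n) 𝓘(ℝ, EMod n) (φ.symm ∘ Prod.fst) y u = fromMod φ y.1 u.1 :=
      DFunLike.congr_fun h3 u
    change y.2.1 u.1 = y.2.1 (toMod φ (φ.symm y.1)
      (mfderiv (IP n) 𝓘(ℝ, EMod n) (φ.symm ∘ Prod.fst) y u))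
    rw [h5]
    exact congrArg y.2.1 (hφ.toMod_fromMod hy.1 u.1).symm) u w
  have hT : ∀ u w, fderiv ℝ T z u w = u.2.1 w.1 := by
    intro u w
    have h3 : HasFDerivAt T _ z := (((ContinuousLinearMap.fst ℝ _ _).comp
      (ContinuousLinearMap.snd ℝ (EMod n) ((EMod n →L[ℝ] ℝ) × Fib n))).hasFDerivAt).clm_comp
        (hasFDerivAt_const (ContinuousLinearMap.fst ℝ (EMod n) ((EMod n →L[ℝ] ℝ) × Fib n)) z)
    rw [h3.fderiv]
    simp
  rw [hT, hT, neg_sub] at h2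
  rw [← h2]
  have h6 : ∀ u, mfderiv (IP n) (ICot n) pr1 ((Mixed.natChart hφ).symm z)
      (Mixed.ofCoord hφ z u) = mfderiv (IP n) (ICot n) (pr1 ∘ (Mixed.natChart hφ).symm) z u :=
    fun u => (DFunLike.congr_fun h1 u).symm
  change canonicalForm _ (mfderiv (IP n) (ICot n) pr1 ((Mixed.natChart hφ).symm z)
    (Mixed.ofCoord hφ z u)) (mfderiv (IP n) (ICot n) pr1 ((Mixed.natChart hφ).symm z)
    (Mixed.ofCoord hφ z w)) = _
  rw [h6, h6]
  rfl

variable {L : J1 n π → ℝ} (hL : ContMDiff (IJ n) 𝓘(ℝ, ℝ) ∞ L)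
include hL

omit hL in
theorem energy_natChart_symm :
    energy L ((Mixed.natChart hφ).symm z) =
      z.2.1 (1, z.2.2) - coordLagrangian hφ L (coordPr2 z) := by
  have h := J1.natChart_symm_vel hφ (coordPr2_mem_target hφ hz)
  have h1 : z.2.1 (toMod φ (φ.symm z.1) ((J1.natChart hφ).symm (coordPr2 z)).vel) =
      z.2.1 (1, z.2.2) := by
    rw [h]
    exact congrArg z.2.1 (hφ.toMod_fromMod hz.1 _)
  exact congrArg₂ (· - ·) h1 rfl

theorem hasFDerivAt_coordEnergy : HasFDerivAt
    (fun z : PMod n => z.2.1 ((1 : ℝ), z.2.2) - coordLagrangian hφ L (coordPr2 z))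
    (z.2.1.comp ((0 : PMod n →L[ℝ] ℝ).prod
      ((ContinuousLinearMap.snd ℝ _ _).comp (ContinuousLinearMap.snd ℝ _ _))) +
      ((ContinuousLinearMap.fst ℝ _ _).comp (ContinuousLinearMap.snd ℝ _ _)).flip (1, z.2.2) -
      (fderiv ℝ (coordLagrangian hφ L) (coordPr2 z)).comp coordPr2) z := by
  have h1 : HasFDerivAt (fun z : PMod n => z.2.1) _ z :=
    ((ContinuousLinearMap.fst ℝ (EMod n →L[ℝ] ℝ) (Fib n)).comp
      (ContinuousLinearMap.snd ℝ (EMod n) _)).hasFDerivAt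
  have h2 : HasFDerivAt (fun z : PMod n => z.2.2) _ z :=
    ((ContinuousLinearMap.snd ℝ (EMod n →L[ℝ] ℝ) (Fib n)).comp
      (ContinuousLinearMap.snd ℝ (EMod n) _)).hasFDerivAt
  have h3 := ((contDiffAt_coordLagrangian hφ (coordPr2_mem_target hφ hz) hL).differentiableAt
    (by simp)).hasFDerivAt
  exact (h1.clm_apply ((hasFDerivAt_const (1 : ℝ) z).prodMk h2)).sub
    (h3.comp z coordPr2.hasFDerivAt)

omit hz in
theorem contMDiff_energy : ContMDiff (IP n) 𝓘(ℝ, ℝ) ∞ (energy L : Mixed n π → ℝ) := by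
  intro p
  obtain ⟨φ, hφ, z, hz, rfl⟩ := Mixed.exists_natChart_symm_eq p
  refine Mixed.contMDiffAt_of_comp_natChart_symm hφ hz ?_
  have h : ContDiffAt ℝ ∞
      (fun z : PMod n => z.2.1 ((1 : ℝ), z.2.2) - coordLagrangian hφ L (coordPr2 z)) z := by
    have h1 : ContDiffAt ℝ ∞ (fun z : PMod n => z.2.1) z := contDiffAt_snd.fst
    have h2 : ContDiffAt ℝ ∞ (fun z : PMod n => ((1 : ℝ), z.2.2)) z :=
      contDiffAt_const.prodMk contDiffAt_snd.snd
    exact (h1.clm_apply h2).sub ((contDiffAt_coordLagrangian hφ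
      (coordPr2_mem_target hφ hz) hL).comp z coordPr2.contDiff.contDiffAt)
  refine (contMDiffAt_iff_contDiffAt.2 h).congr_of_eventuallyEq ?_
  filter_upwards [(Mixed.natChart hφ).open_target.mem_nhds hz] with y hy
  exact energy_natChart_symm hφ hy

/-- Only momentum directions matter later, and the energy is affine in the covector with linear part
evaluation on the velocity. -/
theorem mvfderiv_energy_ofCoord (a : EMod n →L[ℝ] ℝ) :
    mvfderiv (IP n) (energy L) ((Mixed.natChart hφ).symm z) (Mixed.ofCoord hφ z (0, a, 0)) =
      a (1, z.2.2) := by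
  have h1 := mfderiv_comp (I := IP n) (I' := IP n) (I'' := 𝓘(ℝ, ℝ)) z
    ((contMDiff_energy hL).mdifferentiableAt (by simp))
    ((Mixed.contMDiffAt_natChart_symm hφ hz).mdifferentiableAt (by simp))
  rw [mfderiv_eq_fderiv] at h1
  have h2 : energy L ∘ (Mixed.natChart hφ).symm =ᶠ[𝓝 z]
      (fun z : PMod n => z.2.1 ((1 : ℝ), z.2.2) - coordLagrangian hφ L (coordPr2 z)) := by
    filter_upwards [(Mixed.natChart hφ).open_target.mem_nhds hz] with y hy
    exact energy_natChart_symm hφ hy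
  rw [h2.fderiv_eq, (hasFDerivAt_coordEnergy hφ hz hL).fderiv] at h1
  refine (DFunLike.congr_fun h1 (0, a, 0)).symm.trans ?_
  have h3 : fderiv ℝ (coordLagrangian hφ L) (z.1, z.2.2) ((0 : EMod n), (0 : Fib n)) = 0 :=
    map_zero _
  have h4 : z.2.1 ((0 : ℝ), (0 : Fib n)) = 0 := map_zero _
  change z.2.1 (0, 0) + a (1, z.2.2) -
    fderiv ℝ (coordLagrangian hφ L) (z.1, z.2.2) ((0 : EMod n), (0 : Fib n)) = a (1, z.2.2)
  rw [h3, h4, zero_add, sub_zero]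

omit hz in
/-- A vector satisfying the second-order condition is `ω_H`-orthogonal to the fibres of `pr_2`. -/
theorem omegaH_apply_of_mfderiv_pr2_eq_zero (p : Mixed n π) {Z W : TangentSpace (IP n) p}
    (hZ : mfderiv (IJ n) 𝓘(ℝ, EMod n) J1.pt (pr2 p) (mfderiv (IP n) (IJ n) pr2 p Z) = (pr2 p).vel)
    (hη : eta p Z = 1) (hW : mfderiv (IP n) (IJ n) pr2 p W = 0) : omegaH L p Z W = 0 := by
  obtain ⟨φ, hφ, z, hz, rfl⟩ := Mixed.exists_natChart_symm_eq p
  have hz2 := coordPr2_mem_target hφ hz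
  obtain ⟨u, rfl⟩ := Mixed.ofCoord_surjective hφ hz Z
  obtain ⟨⟨y, a, w⟩, rfl⟩ := Mixed.ofCoord_surjective hφ hz W
  have hWη : eta _ (Mixed.ofCoord hφ z (y, a, w)) = 0 := by rw [eta_eq_etaJ, hW, map_zero]
  rw [mfderiv_pr2_ofCoord hφ hz] at hW hZ
  -- The kernel of the differential of `pr2` consists of the momentum directions `(0, a, 0)`.
  have hyw : coordPr2 (y, a, w) = 0 :=
    (J1.ofCoord_bijective hφ hz2).1 (hW.trans (map_zero _).symm)
  obtain rfl : y = 0 := congrArg Prod.fst hyw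
  obtain rfl : w = 0 := congrArg Prod.snd hyw
  -- The second-order condition in coordinates.
  have hu : u.1 = (1, z.2.2) := by
    have h1 := (J1.mfderiv_pt_ofCoord hφ hz2 (coordPr2 u)).symm.trans
      (hZ.trans (J1.natChart_symm_vel hφ hz2))
    have h2 := congrArg (toMod φ (φ.symm z.1)) h1
    exact ((hφ.toMod_fromMod hz.1 _).symm.trans h2).trans (hφ.toMod_fromMod hz.1 _)
  change pullbackForm (IP n) (ICot n) pr1 canonicalForm _ _ _ +
    (mvfderiv (IP n) (energy L) _ _ * eta _ _ - mvfderiv (IP n) (energy L) _ _ * eta _ _) = 0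
  -- The canonical form contributes `a (1, q̇)` and the wedge term `-a (1, q̇)`.
  rw [hη, hWη, canonicalForm_ofCoord hφ hz, mvfderiv_energy_ofCoord hφ hz hL, hu]
  simp

end MixedCoordinates

/-! ### The graph of the Legendre map: comparison of `ω_H` with `ω_L`, and the solutions. -/

section Graph
set_option linter.unusedSectionVars false
variable {n : ℕ} {E : Type u} [TopologicalSpace E] [ChartedSpace (EMod n) E]
  [IsManifold 𝓘(ℝ, EMod n) ∞ E] {π : E → ℝ} [IsFibreBundle n π]
  {L : J1 n π → ℝ} (hL : ContMDiff (IJ n) 𝓘(ℝ, ℝ) ∞ L)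
include hL

/-- The map `Leg_L ×_E id` in natural coordinates. -/
theorem natChart_graphMap {φ : OpenPartialHomeomorph E (EMod n)} (hφ : IsBundleChart π φ)
    {z : EMod n × Fib n} (hz : z ∈ (J1.natChart hφ).target) :
    Mixed.natChart hφ (graphMap L ((J1.natChart hφ).symm z)) =
      (z.1, (coordTheta (coordLagrangian hφ L) z).comp (ContinuousLinearMap.inl ℝ _ _), z.2) := by
  have h := congrArg Prod.snd ((J1.natChart hφ).right_inv hz)
  refine Prod.ext (φ.right_inv hz.1) (Prod.ext ?_ h)
  change legendreCov L ((J1.natChart hφ).symm z) ∘L (toMod φ (φ.symm z.1)).inverse = _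
  rw [hφ.toMod_inverse hz.1]
  exact ContinuousLinearMap.ext fun u => legendreCov_fromMod hφ hz hL u

theorem contMDiff_graphMap : ContMDiff (IJ n) (IP n) ∞ (graphMap L) := by
  intro v
  obtain ⟨φ, hφ, z, hz, rfl⟩ := J1.exists_natChart_symm_eq v
  have hs := (J1.natChart hφ).map_target hz
  let G : EMod n × Fib n → PMod n := fun z =>
    (z.1, (coordTheta (coordLagrangian hφ L) z).comp (ContinuousLinearMap.inl ℝ _ _), z.2)
  have hG : ContDiffAt ℝ ∞ G z :=
    contDiffAt_fst.prodMk (((contDiffAt_coordTheta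
      (contDiffAt_coordLagrangian hφ hz hL)).clm_comp contDiffAt_const).prodMk contDiffAt_snd)
  have hGz : G z ∈ (Mixed.natChart hφ).target := ⟨hz.1, mem_univ _⟩
  have h1 : ContMDiffAt (IJ n) (IP n) ∞ ((Mixed.natChart hφ).symm ∘ G)
      (J1.natChart hφ ((J1.natChart hφ).symm z)) := by
    rw [(J1.natChart hφ).right_inv hz]
    exact (Mixed.contMDiffAt_natChart_symm hφ hGz).comp z (contMDiffAt_iff_contDiffAt.2 hG)
  refine (h1.comp _ ((J1.contMDiffOn_natChart hφ).contMDiffAt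
    ((J1.natChart hφ).open_source.mem_nhds hs))).congr_of_eventuallyEq ?_
  filter_upwards [(J1.natChart hφ).open_source.mem_nhds hs] with v hv
  have h2 := natChart_graphMap hL hφ ((J1.natChart hφ).map_source hv)
  rw [(J1.natChart hφ).left_inv hv] at h2
  have h3 : graphMap L v ∈ (Mixed.natChart hφ).source := hv
  change _ = (Mixed.natChart hφ).symm (G (J1.natChart hφ v))
  rw [← (Mixed.natChart hφ).left_inv h3, h2]

/-- The energy vanishes on the graph of the Legendre map. -/
theorem energy_graphMap (v : J1 n π) : energy L (graphMap L v) = 0 := by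
  obtain ⟨φ, hφ, z, hz, rfl⟩ := J1.exists_natChart_symm_eq v
  -- The velocity `(1, q̇)` is annihilated by the contact forms `dq - q̇ dt`, so only `l dt`
  -- contributes to the pairing.
  have h := legendreCov_fromMod hφ hz hL (1, z.2)
  rw [← J1.natChart_symm_vel hφ hz, coordTheta_apply] at h
  have h0 : fderiv ℝ (coordLagrangian hφ L) z (0, 0) = 0 := map_zero _
  simp only [one_smul, sub_self, h0, mul_one, add_zero] at h
  exact sub_eq_zero.2 h

/-- `graphMap L` is a section of `pr2`. This splits the tangent space at a point of the graph into
the tangent space of the graph and the kernel of the differential of `pr2`. -/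
theorem mfderiv_pr2_graphMap (v : J1 n π) (X : TangentSpace (IJ n) v) :
    mfderiv (IP n) (IJ n) pr2 (graphMap L v) (mfderiv (IJ n) (IP n) (graphMap L) v X) = X := by
  have h1 := mfderiv_comp (I := IJ n) (I' := IP n) (I'' := IJ n) v
    (g := (pr2 : Mixed n π → J1 n π)) (f := graphMap L)
    (contMDiff_pr2.mdifferentiableAt (by simp))
    ((contMDiff_graphMap hL).mdifferentiableAt (by simp))
  have h2 : (pr2 : Mixed n π → J1 n π) ∘ graphMap L = id := rfl
  rw [h2, mfderiv_id] at h1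
  exact (DFunLike.congr_fun h1 X).symm

theorem eta_graphMap (v : J1 n π) (X : TangentSpace (IJ n) v) :
    eta (graphMap L v) (mfderiv (IJ n) (IP n) (graphMap L) v X) = etaJ v X := by
  rw [eta_eq_etaJ, mfderiv_pr2_graphMap hL]
  rfl

theorem mvfderiv_energy_graphMap (v : J1 n π) (X : TangentSpace (IJ n) v) :
    mvfderiv (IP n) (energy L) (graphMap L v) (mfderiv (IJ n) (IP n) (graphMap L) v X) = 0 := by
  have h1 := mfderiv_comp (I := IJ n) (I' := IP n) (I'' := 𝓘(ℝ, ℝ)) v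
    ((contMDiff_energy hL).mdifferentiableAt (by simp))
    ((contMDiff_graphMap hL).mdifferentiableAt (by simp))
  have h2 : energy L ∘ graphMap L = fun _ => 0 := funext fun v => energy_graphMap hL v
  rw [h2, mfderiv_const] at h1
  exact (DFunLike.congr_fun h1 X).symm

/-- The pull-back of `ω_H` along `Leg_L ×_E id` is `ω_L`. -/
theorem omegaH_graphMap (v : J1 n π) (X Y : TangentSpace (IJ n) v) :
    omegaH L (graphMap L v) (mfderiv (IJ n) (IP n) (graphMap L) v X)
      (mfderiv (IJ n) (IP n) (graphMap L) v Y) = omegaL L v X Y := by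
  obtain ⟨φ, hφ, z, hz, rfl⟩ := J1.exists_natChart_symm_eq v
  obtain ⟨u, rfl⟩ := (J1.ofCoord_bijective hφ hz).2 X
  obtain ⟨w, rfl⟩ := (J1.ofCoord_bijective hφ hz).2 Y
  have hleg : ContMDiff (IJ n) (ICot n) ∞ (legendre L) :=
    contMDiff_pr1.comp (contMDiff_graphMap hL)
  have h1 := mfderiv_comp (I := IJ n) (I' := IP n) (I'' := ICot n) ((J1.natChart hφ).symm z)
    (g := (pr1 : Mixed n π → CotBundle n E)) (f := graphMap L)
    (contMDiff_pr1.mdifferentiableAt (by simp))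
    ((contMDiff_graphMap hL).mdifferentiableAt (by simp))
  have h2 := mfderiv_comp (I := IJ n) (I' := IJ n) (I'' := ICot n) z
    (g := legendre L) (f := (J1.natChart hφ).symm) (hleg.mdifferentiableAt (by simp))
    ((J1.contMDiffAt_natChart_symm hφ hz).mdifferentiableAt (by simp))
  have h3 : ∀ u, mfderiv (IP n) (ICot n) pr1 (graphMap L ((J1.natChart hφ).symm z))
      (mfderiv (IJ n) (IP n) (graphMap L) ((J1.natChart hφ).symm z) (J1.ofCoord hφ z u)) =
      mfderiv (IJ n) (ICot n) (legendre L ∘ (J1.natChart hφ).symm) z u := fun u =>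
    (DFunLike.congr_fun h1 (J1.ofCoord hφ z u)).symm.trans (DFunLike.congr_fun h2 u).symm
  -- The Legendre map pulls the Liouville form back to `Θ_L` by `legendreCov_apply`, hence the
  -- canonical form to `-dΘ_L`.
  have h4 := canonicalForm_mfderiv
    (hleg.contMDiffAt.comp z (J1.contMDiffAt_natChart_symm hφ hz))
    (T := coordTheta (coordLagrangian hφ L)) (by
      filter_upwards [(J1.natChart hφ).open_target.mem_nhds hz] with y hy u
      have h5 := mfderiv_comp (I := IJ n) (I' := IJ n) (I'' := 𝓘(ℝ, EMod n)) y
        (g := (J1.pt : J1 n π → E)) (f := (J1.natChart hφ).symm)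
        (contMDiff_pt.mdifferentiableAt (by simp))
        ((J1.contMDiffAt_natChart_symm hφ hy).mdifferentiableAt (by simp))
      rw [← poincareCartan_ofCoord hφ hy hL, ← legendreCov_apply]
      exact congrArg (legendreCov L ((J1.natChart hφ).symm y)) (DFunLike.congr_fun h5 u).symm) u w
  rw [← omegaL_ofCoord hφ hz hL] at h4
  rw [← h4]
  have h5 : pullbackForm (IP n) (ICot n) pr1 canonicalForm
      (graphMap L ((J1.natChart hφ).symm z))
      (mfderiv (IJ n) (IP n) (graphMap L) _ (J1.ofCoord hφ z u))
      (mfderiv (IJ n) (IP n) (graphMap L) _ (J1.ofCoord hφ z w)) =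
      canonicalForm ((legendre L ∘ (J1.natChart hφ).symm) z)
        (mfderiv (IJ n) (ICot n) (legendre L ∘ (J1.natChart hφ).symm) z u)
        (mfderiv (IJ n) (ICot n) (legendre L ∘ (J1.natChart hφ).symm) z w) :=
    congrArg₂ (fun a b => canonicalForm (legendre L ((J1.natChart hφ).symm z)) a b) (h3 u) (h3 w)
  -- The energy is constant on the graph, so the wedge term vanishes on tangent vectors.
  have h6 : ∀ (p : Mixed n π) (Z W : TangentSpace (IP n) p), mvfderiv (IP n) (energy L) p Z = 0 →
      mvfderiv (IP n) (energy L) p W = 0 → omegaH L p Z W =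
        pullbackForm (IP n) (ICot n) pr1 canonicalForm p Z W := by
    intro p Z W h h'
    change _ + (mvfderiv (IP n) (energy L) p Z * eta p W -
      mvfderiv (IP n) (energy L) p W * eta p Z) = _
    rw [h, h', zero_mul, zero_mul, sub_zero, add_zero]
  exact (h6 _ _ _ (mvfderiv_energy_graphMap hL _ _) (mvfderiv_energy_graphMap hL _ _)).trans h5

variable (hreg : IsRegular L)
include hreg

theorem existsUnique_eulerLagrange (v : J1 n π) :
    ∃! X : TangentSpace (IJ n) v, omegaL L v X = 0 ∧ etaJ v X = 1 := by
  obtain ⟨φ, hφ, z, hz, rfl⟩ := J1.exists_natChart_symm_eq v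
  exact ⟨_, (eulerLagrange_iff hφ hz hL hreg _).2 rfl,
    fun X hX => (eulerLagrange_iff hφ hz hL hreg X).1 hX⟩

/-- The Euler–Lagrange field is a second-order field. -/
theorem mfderiv_pt_eulerLagrange {v : J1 n π} {X : TangentSpace (IJ n) v}
    (hX : omegaL L v X = 0 ∧ etaJ v X = 1) :
    mfderiv (IJ n) 𝓘(ℝ, EMod n) J1.pt v X = v.vel := by
  obtain ⟨φ, hφ, z, hz, rfl⟩ := J1.exists_natChart_symm_eq v
  obtain rfl := (eulerLagrange_iff hφ hz hL hreg X).1 hX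
  rw [J1.mfderiv_pt_ofCoord hφ hz, J1.natChart_symm_vel hφ hz]
  rfl

/-- On vectors tangent to the graph, the equations for `ω_H` and for `ω_L` are equivalent. -/
theorem omegaH_graphMap_eq_zero_iff {v : J1 n π} {X : TangentSpace (IJ n) v} :
    (omegaH L (graphMap L v) (mfderiv (IJ n) (IP n) (graphMap L) v X) = 0 ∧
      eta (graphMap L v) (mfderiv (IJ n) (IP n) (graphMap L) v X) = 1) ↔
      (omegaL L v X = 0 ∧ etaJ v X = 1) := by
  rw [eta_graphMap hL]
  constructor
  · rintro ⟨h, hη⟩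
    refine ⟨LinearMap.ext fun Y => ?_, hη⟩
    rw [← omegaH_graphMap hL, h]
    rfl
  · rintro ⟨h, hη⟩
    refine ⟨LinearMap.ext fun W => ?_, hη⟩
    -- `W` is the push-forward of `Y`, handled by `omegaH_graphMap`, plus a remainder killed by the
    -- differential of `pr2`, handled by the second-order condition.
    obtain ⟨Y, hY⟩ : ∃ Y : TangentSpace (IJ n) v,
        mfderiv (IP n) (IJ n) pr2 (graphMap L v) W = Y := ⟨_, rfl⟩
    have h1 : omegaH L (graphMap L v) (mfderiv (IJ n) (IP n) (graphMap L) v X)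
        (mfderiv (IJ n) (IP n) (graphMap L) v Y) = 0 := by
      refine (omegaH_graphMap hL v X Y).trans ?_
      rw [h]
      rfl
    have h2 : omegaH L (graphMap L v) (mfderiv (IJ n) (IP n) (graphMap L) v X)
        (W - mfderiv (IJ n) (IP n) (graphMap L) v Y) = 0 := by
      apply omegaH_apply_of_mfderiv_pr2_eq_zero hL
      · rw [mfderiv_pr2_graphMap hL]
        exact mfderiv_pt_eulerLagrange hL hreg ⟨h, hη⟩
      · rw [eta_graphMap hL, hη]
      · rw [map_sub]
        exact sub_eq_zero.2 (hY.trans (mfderiv_pr2_graphMap hL v Y).symm)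
    rw [map_sub, h1, sub_zero] at h2
    exact h2

/-- By pointwise uniqueness `X` is, on a natural chart, the push-forward of `coordField`; so locally
it is the tangent map of the inverse chart composed with a smooth section. -/
theorem IsEulerLagrangeField.isSmoothField {X : ∀ v : J1 n π, TangentSpace (IJ n) v}
    (hX : IsEulerLagrangeField L X) : IsSmoothField X := by
  intro v
  have : IsManifold (IJ n) 1 (J1 n π) := IsManifold.of_le (n := ∞) (by simp)
  obtain ⟨φ, hφ, z, hz, rfl⟩ := J1.exists_natChart_symm_eq v
  set c := J1.natChart hφ with hc
  have hs := c.map_target hz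
  let F : EMod n × Fib n → TangentBundle (IJ n) (EMod n × Fib n) :=
    fun y => ⟨y, coordField (coordLagrangian hφ L) y⟩
  have hF : ContMDiffAt (IJ n) (IJ n).tangent ∞ F z :=
    contMDiffAt_vectorSpace_iff_contDiffAt.2 (contDiffAt_coordField
      (contDiffAt_coordLagrangian hφ hz hL) (velHessian_injective hφ hz hL hreg))
  have hT := (J1.contMDiffOn_natChart_symm hφ).contMDiffOn_tangentMapWithin (m := ∞) (by simp)
    c.open_target.uniqueMDiffOn
  have hFz : ContMDiffAt (IJ n).tangent (IJ n).tangent ∞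
      (tangentMapWithin (IJ n) (IJ n) c.symm c.target) (F z) :=
    hT.contMDiffAt ((c.open_target.preimage
      (FiberBundle.continuous_proj (EMod n × Fib n) (TangentSpace (IJ n)))).mem_nhds hz)
  have h1 : ContMDiffAt (IJ n) (IJ n).tangent ∞
      (tangentMapWithin (IJ n) (IJ n) c.symm c.target ∘ F) (c (c.symm z)) := by
    rw [c.right_inv hz]
    exact hFz.comp z hF
  refine (h1.comp _ ((J1.contMDiffOn_natChart hφ).contMDiffAt
    (c.open_source.mem_nhds hs))).congr_of_eventuallyEq ?_
  filter_upwards [c.open_source.mem_nhds hs] with v hv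
  obtain ⟨y, hy, rfl⟩ : ∃ y ∈ c.target, c.symm y = v := ⟨c v, c.map_source hv, c.left_inv hv⟩
  have h2 : tangentMapWithin (IJ n) (IJ n) c.symm c.target (F y) =
      tangentMap (IJ n) (IJ n) c.symm (F y) :=
    tangentMapWithin_eq_tangentMap (c.open_target.uniqueMDiffOn y hy)
      ((J1.contMDiffAt_natChart_symm hφ hy).mdifferentiableAt (by simp))
  have h3 : X (c.symm y) = J1.ofCoord hφ y (coordField (coordLagrangian hφ L) y) :=
    (eulerLagrange_iff hφ hy hL hreg (X (c.symm y))).1 ⟨hX.omegaL_eq _, hX.eta_eq _⟩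
  change _ = tangentMapWithin (IJ n) (IJ n) c.symm c.target (F (c (c.symm y)))
  rw [c.right_inv hy, h2]
  exact congrArg (Bundle.TotalSpace.mk (c.symm y)) h3

/-- Tangency gives `Z = g_*Y`, and `Y` solves the Euler–Lagrange equation, whose solution is unique.
-/
theorem eq_mfderiv_graphMap_of_mem_range {v : J1 n π} {X : TangentSpace (IJ n) v}
    {Z : TangentSpace (IP n) (graphMap L v)} (hX : omegaL L v X = 0 ∧ etaJ v X = 1)
    (hZ : omegaH L (graphMap L v) Z = 0) (hη : eta (graphMap L v) Z = 1)
    (ht : Z ∈ (mfderiv (IJ n) (IP n) (graphMap L) v).range) :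
    Z = mfderiv (IJ n) (IP n) (graphMap L) v X := by
  obtain ⟨Y, rfl⟩ := ht
  exact congrArg (mfderiv (IJ n) (IP n) (graphMap L) v)
    ((existsUnique_eulerLagrange hL hreg v).unique
      ((omegaH_graphMap_eq_zero_iff hL hreg).1 ⟨hZ, hη⟩) hX)

theorem IsSRSolution.eq_mfderiv_graphMap {X : ∀ v : J1 n π, TangentSpace (IJ n) v}
    {Z : ∀ p : graphL L, TangentSpace (IP n) p.1} (hX : IsEulerLagrangeField L X)
    (hZ : IsSRSolution L Z) (v : J1 n π) :
    Z ⟨graphMap L v, v, rfl⟩ = mfderiv (IJ n) (IP n) (graphMap L) v (X v) :=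
  eq_mfderiv_graphMap_of_mem_range hL hreg ⟨hX.omegaL_eq v, hX.eta_eq v⟩
    (hZ.omegaH_eq ⟨graphMap L v, v, rfl⟩) (hZ.eta_eq ⟨graphMap L v, v, rfl⟩) (hZ.tangent v)

/-- `pr2` inverts `graphMap L` on the graph, so no preimage has to be chosen. The vector lies over
`graphMap L (pr2 p.1)`, which equals `p.1` only propositionally; the ascription to `PMod n`
identifies the two tangent spaces. -/
theorem isSRSolution_mfderiv_graphMap {X : ∀ v : J1 n π, TangentSpace (IJ n) v}
    (hX : IsEulerLagrangeField L X) :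
    IsSRSolution L (fun p => (mfderiv (IJ n) (IP n) (graphMap L) (pr2 p.1) (X (pr2 p.1)) :
      PMod n)) := by
  have h := fun v => (omegaH_graphMap_eq_zero_iff hL hreg (X := X v)).2
    ⟨hX.omegaL_eq v, hX.eta_eq v⟩
  refine ⟨?_, ?_, fun v => ⟨X v, rfl⟩⟩
  · rintro ⟨_, v, rfl⟩
    exact (h v).1
  · rintro ⟨_, v, rfl⟩
    exact (h v).2

end Graph

end SkinnerRusk
end

/-! ### Assembly of existence, uniqueness, smoothness and relatedness. -/

theorem mainTheorem1 {n : ℕ} {E : Type*} [TopologicalSpace E] [ChartedSpace (SkinnerRusk.EMod n) E]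
    [IsManifold 𝓘(ℝ, SkinnerRusk.EMod n) ∞ E] (π : E → ℝ) [SkinnerRusk.IsFibreBundle n π]
    (L : SkinnerRusk.J1 n π → ℝ) (hL : ContMDiff (SkinnerRusk.IJ n) 𝓘(ℝ, ℝ) ∞ L)
    (hreg : SkinnerRusk.IsRegular L) :
    (∃! X : ∀ v : SkinnerRusk.J1 n π, TangentSpace (SkinnerRusk.IJ n) v,
      SkinnerRusk.IsEulerLagrangeField L X) ∧
    (∃! Z : ∀ p : SkinnerRusk.graphL L, TangentSpace (SkinnerRusk.IP n) p.1,
      SkinnerRusk.IsSRSolution L Z) ∧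
    ∀ X Z, SkinnerRusk.IsEulerLagrangeField L X → SkinnerRusk.IsSRSolution L Z →
      SkinnerRusk.IsSmoothField X ∧ SkinnerRusk.IsSmoothAlong L Z ∧
      ∀ v : SkinnerRusk.J1 n π, Z ⟨SkinnerRusk.graphMap L v, v, rfl⟩ =
        mfderiv (SkinnerRusk.IJ n) (SkinnerRusk.IP n) (SkinnerRusk.graphMap L) v (X v) := by
  have hex := SkinnerRusk.existsUnique_eulerLagrange hL hreg
  choose X hX hX' using hex
  have hXL : SkinnerRusk.IsEulerLagrangeField L X := ⟨fun v => (hX v).1, fun v => (hX v).2⟩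
  refine ⟨⟨X, hXL, fun Y hY => funext fun v => hX' v _ ⟨hY.omegaL_eq v, hY.eta_eq v⟩⟩,
    ⟨_, SkinnerRusk.isSRSolution_mfderiv_graphMap hL hreg hXL, fun Z hZ => ?_⟩, ?_⟩
  · funext p
    obtain ⟨_, v, rfl⟩ := p
    exact hZ.eq_mfderiv_graphMap hL hreg hXL v
  · intro Y Z hY hZ
    have hrel := hZ.eq_mfderiv_graphMap hL hreg hY
    have hs := hY.isSmoothField hL hreg
    refine ⟨hs, ?_, hrel⟩
    have h1 : IsManifold (SkinnerRusk.IJ n) 1 (SkinnerRusk.J1 n π) :=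
      IsManifold.of_le (n := ∞) (by simp)
    have h2 : IsManifold (SkinnerRusk.IP n) 1 (SkinnerRusk.Mixed n π) :=
      IsManifold.of_le (n := ∞) (by simp)
    have h3 := ((SkinnerRusk.contMDiff_graphMap hL).contMDiff_tangentMap (m := ∞) (by simp)).comp hs
    -- Relatedness presents `Z` along the graph as the tangent map of `graphMap L` composed with the
    -- smooth field `Y`.
    have h4 : (fun v => (⟨SkinnerRusk.graphMap L v, Z ⟨SkinnerRusk.graphMap L v, v, rfl⟩⟩ :
        TangentBundle (SkinnerRusk.IP n) (SkinnerRusk.Mixed n π))) =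
        tangentMap (SkinnerRusk.IJ n) (SkinnerRusk.IP n) (SkinnerRusk.graphMap L) ∘
          fun v => ⟨v, Y v⟩ := by
      funext v
      rw [hrel v]
      rfl
    unfold SkinnerRusk.IsSmoothAlong
    rw [h4]
    exact h3
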